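/- \textbf{Setting.} Let $1<a<2$ and $p>0$ be real numbers, and let $\psi$ be the Cauchy wavelet of order $p$, i.e. the function on $\mathbb R$ with Fourier transform $\hat\psi(\omega)=\int_{\mathbb R}\psi(x)e^{-i\omega x}\,dx=\omega^pe^{-\omega}1_{\omega>0}$. For $l\in\mathbb R$ let $\psi_l(x)=a^{-l}\psi(a^{-l}x)$. Let $f^{(1)},f^{(2)}\in L^2(\mathbb R)$ be non-zero and set $$N_l=\sup_{x\in\mathbb R,\ s=1,2}|f^{(s)}\star\psi_l(x)|\qquad(l\in\mathbb R).$$ Fix $j\in\mathbb Z$, an even integer $K\ge 2$, $\epsilon,\kappa\in(0,1)$, $M>0$, and an integer $k\ge1$ with $a^{-k}<2-a$. Define $$c=1-\frac{a-1}{1-a^{-k}}\in(0,1),\qquad d_M=c-4\,\frac{e^{-\pi M/(K+2)}}{1-e^{-\pi M/(K+2)}},\qquad n_s=j+K-2s,$$ $$C_K=\frac{6}{1-\sqrt\kappa}\prod_{s=0}^{K/2-1}\left(a^{p(k-1)}\frac{N_{n_s-1-k}}{N_{n_s-2}}\right),$$ and let $J\in\mathbb R$ be defined by $a^J=\frac{2}{a+1}a^{j+K}+\frac{a-1}{a+1}a^j$.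 (One has $N_l>0$ for all $l$, unless $\hat f^{(1)}$ and $\hat f^{(2)}$ both vanish almost everywhere on $(0,\infty)$; in that degenerate case all $N_l$ are $0$ and both sides of the inequality below are read as $0$.) \textbf{Theorem.} Assume that $\kappa\ge\epsilon^{2(1-c)}$ and that, for all $x\in[-Ma^{j+K},Ma^{j+K}]$ and all $l=j+1,\dots,j+K$, $$\left||f^{(1)}\star\psi_l(x)|^2-|f^{(2)}\star\psi_l(x)|^2\right|\le\epsilon N_l^2,\qquad |f^{(1)}\star\psi_l(x)|^2\ge\kappa N_l^2,\qquad |f^{(2)}\star\psi_l(x)|^2\ge\kappa N_l^2 .$$ Then $J\in[j+K-1,j+K]$ and, for all $x\in\left[-\frac{Ma^{j+K}}{2},\frac{Ma^{j+K}}{2}\right]$, $$\frac{1}{N_JN_j}\left|\overline{f^{(1)}\star\psi_J(x)}\,\bigl(f^{(1)}\star\psi_j(x)\bigr)-\overline{f^{(2)}\star\psi_J(x)}\,\bigl(f^{(2)}\star\psi_j(x)\bigr)\right|\le\frac{C_K}{\kappa^{K/4}}\,\epsilon^{d_M}.$$ -/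

import Mathlib

open MeasureTheory Set
open scoped ComplexConjugate

noncomputable section

namespace CauchyWavelet

/-- The Cauchy wavelet of order `p`: the inverse Fourier transform, with the convention
`ψ(x) = (1 / 2π) ∫ ψ̂(ω) e^{iωx} dω`, of `ψ̂(ω) = ω ^ p * e^{-ω} * 1_{ω > 0}`. -/
def psi (p : ℝ) (x : ℝ) : ℂ :=
  (1 / (2 * Real.pi) : ℂ) *
    ∫ ω in Ioi (0 : ℝ),
      ((ω ^ p * Real.exp (-ω) : ℝ) : ℂ) * Complex.exp (Complex.I * ω * x)

/-- The dilated wavelet `ψ_l(x) = a^{-l} ψ(a^{-l} x)`, that is `ψ̂_l(ω) = ψ̂(a^l ω)`,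
for an arbitrary real index `l`. -/
def psiDil (a p l : ℝ) (x : ℝ) : ℂ :=
  ((a ^ (-l) : ℝ) : ℂ) * psi p (a ^ (-l) * x)

/-- The wavelet transform `(f ⋆ ψ_l)(x) = ∫ f(t) ψ_l(x - t) dt`. -/
def wt (a p : ℝ) (f : ℝ → ℂ) (l : ℝ) (x : ℝ) : ℂ :=
  MeasureTheory.convolution f (psiDil a p l) (ContinuousLinearMap.mul ℂ ℂ) volume x

/-- `N_l = sup { |f^{(s)} ⋆ ψ_l (x)| : x ∈ ℝ, s = 1, 2 }` (the set is bounded when both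
functions are in `L²`). -/
def supN (a p : ℝ) (f : Fin 2 → ℝ → ℂ) (l : ℝ) : ℝ :=
  ⨆ q : Fin 2 × ℝ, ‖wt a p (f q.1) l q.2‖

/-- The real number `J` with `a ^ J = 2 / (a + 1) * a ^ (j + K) + (a - 1) / (a + 1) * a ^ j`. -/
def indexJ (a : ℝ) (j : ℤ) (K : ℕ) : ℝ :=
  Real.logb a (2 / (a + 1) * a ^ ((j : ℝ) + K) + (a - 1) / (a + 1) * a ^ (j : ℝ))

/-- `c = 1 - (a - 1) / (1 - a^{-k})`. -/
def expC (a : ℝ) (k : ℕ) : ℝ :=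
  1 - (a - 1) / (1 - a ^ (-(k : ℝ)))

/-- `d_M = c - 4 e^{-πM/(K+2)} / (1 - e^{-πM/(K+2)})`. -/
def expD (a : ℝ) (k K : ℕ) (M : ℝ) : ℝ :=
  expC a k - 4 * (Real.exp (-Real.pi * M / (K + 2)) / (1 - Real.exp (-Real.pi * M / (K + 2))))

/-- `n_s = j + K - 2 s`. -/
def idx (j : ℤ) (K s : ℕ) : ℝ := (j : ℝ) + K - 2 * s

/-- `C_K = 6 / (1 - √κ) * ∏_{s=0}^{K/2-1} (a^{p(k-1)} N_{n_s-1-k} / N_{n_s-2})`. -/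
def constC (a p : ℝ) (f : Fin 2 → ℝ → ℂ) (j : ℤ) (K k : ℕ) (κ : ℝ) : ℝ :=
  6 / (1 - Real.sqrt κ) *
    ∏ s ∈ Finset.range (K / 2),
      (a ^ (p * ((k : ℝ) - 1)) *
        (supN a p f (idx j K s - 1 - k) / supN a p f (idx j K s - 2)))

end CauchyWavelet

end

/-!
The wavelet transform at scale `l` is, up to the factor `a ^ (p l)`, the restriction to the line
`im z = a ^ l` of a function `F` which is holomorphic on the upper half plane and bounded on each
half plane `im z ≥ δ > 0`: the Cauchy integral `holExt` (`wt_eq`). Thus the moduli of two such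
functions are nearly equal on the lines of heights `a ^ (j + 1), …, a ^ (j + K)`, for `|x| ≤ X`
with `X = M a ^ (j + K)`, and the products `F (x + i v) * conj (F (x + i w))` have to be compared
for `v = a ^ J`, `w = a ^ j`.

For a fixed midpoint `m`, the product `F (x + i (m + β)) * conj (F (x + i (m - β)))` is holomorphic
in `x + i β`, and equals the squared modulus at height `m` when `β = 0`. A maximum principle in the
half strip `0 ≤ β ≤ h` then gives an error `ε ^ (1 - β / h)` for the products
(`norm_crossDiff_le_of_modulus`); the same principle in the strip `|β| ≤ h` shows that errors do
not grow when both heights move towards their midpoint (`norm_crossDiff_le_of_outer`). As bounds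
are only known for `|x| ≤ X`, the comparison functions contain the harmonic function
`cosh (l x) cos (l y) / cosh (l X)`, which on the vertical sides of the rectangle makes the claim no
stronger than the trivial bound. Its restriction to a horizontal line has the same profile on every
line, so that it can be carried through all steps, at the price of a bounded product of factors
`1 / cos`.

The pair `a ^ J, a ^ j` is reached by induction (`norm_crossDiff_high_low_le`). If the products are
controlled at the heights `v, u`, where `u = a ^ n` is a height of known modulus, then so they are
at `u` and its reflection `w` through `a ^ (n - 1)`, with error `ε ^ c`; dividing by `|F|²` at
height `u`, which is bounded below, they are controlled at `v, w`
(`norm_crossDiff_reflect_le`). Moving both heights towards their midpoint until the lower one is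
`a ^ (n - 2)` completes the step. Constants are compared through the inequalities
`μ v * μ w ≤ μ v' * μ w'` for nested pairs with a common midpoint, where `μ y` is the supremum on
the line of height `y` (`lineSup_mul_le`), and through the monotonicity of `μ`.
-/

/-! ### The wavelet transform as a Cauchy integral -/

namespace CauchyWavelet

open Complex in
/-- The Cauchy kernel `(-i (z - t)) ^ (-q)` of order `q`, holomorphic in `z` on the upper half
plane. -/
noncomputable def cauchyKernel (q : ℝ) (z : ℂ) (t : ℝ) : ℂ := (-(I * (z - t))) ^ ((-q : ℝ) : ℂ)

/-- The holomorphic function on the upper half plane whose restrictions to horizontal lines are,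
up to scaling, the wavelet transforms of `f`. -/
noncomputable def holExt (p : ℝ) (f : ℝ → ℂ) (z : ℂ) : ℂ :=
  ((Real.Gamma (p + 1) / (2 * Real.pi) : ℝ) : ℂ) * ∫ t, f t * cauchyKernel (p + 1) z t

lemma norm_cauchyKernel (q : ℝ) (z : ℂ) (t : ℝ) :
    ‖cauchyKernel q z t‖ = ‖z - t‖ ^ (-q) := by
  rw [cauchyKernel, Complex.norm_cpow_real]; simp

lemma sub_ofReal_im_pos {z : ℂ} (hz : 0 < z.im) (t : ℝ) :
    0 < (-(Complex.I * (z - t))).re := by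
  simpa using hz

lemma hasDerivAt_cauchyKernel (q : ℝ) {z : ℂ} (hz : 0 < z.im) (t : ℝ) :
    HasDerivAt (fun z => cauchyKernel q z t)
      (((-q : ℝ) : ℂ) * cauchyKernel (q + 1) z t * -Complex.I) z := by
  have h1 : HasDerivAt (fun z : ℂ => -(Complex.I * (z - t))) (-Complex.I) z := by
    simpa using (((hasDerivAt_id' z).sub_const (t : ℂ)).const_mul Complex.I).fun_neg
  have h2 := h1.cpow_const (c := ((-q : ℝ) : ℂ)) (Or.inl (sub_ofReal_im_pos hz t))
  have h3 : ((-(q + 1) : ℝ) : ℂ) = ((-q : ℝ) : ℂ) - 1 := by push_cast; ring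
  rw [cauchyKernel, h3]
  exact h2

lemma continuous_cauchyKernel (q : ℝ) {z : ℂ} (hz : 0 < z.im) :
    Continuous (cauchyKernel q z) := by
  unfold cauchyKernel
  refine Continuous.cpow (by fun_prop) continuous_const fun t => Or.inl (sub_ofReal_im_pos hz t)

lemma integrable_rpow_const_add_sq {δ q : ℝ} (hδ : 0 < δ) (hq : 1 < q) :
    Integrable fun t : ℝ => (δ ^ 2 + t ^ 2) ^ (-q) := by
  have h := integrable_rpow_neg_one_add_norm_sq (E := ℝ) (μ := volume) (r := 2 * q)
    (by simp; linarith)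
  refine (h.const_mul ((min (δ ^ 2) 1) ^ (-q))).mono' ?_ ?_
  · have : Continuous fun t : ℝ => (δ ^ 2 + t ^ 2) ^ (-q) :=
      Continuous.rpow_const (by fun_prop) fun t => Or.inl (by positivity)
    exact this.aestronglyMeasurable
  · refine Filter.Eventually.of_forall fun t => ?_
    have hm : 0 < min (δ ^ 2) 1 := by positivity
    rw [Real.norm_of_nonneg (by positivity), show -(2 * q) / 2 = -q by ring,
      ← Real.mul_rpow hm.le (by positivity)]
    refine Real.rpow_le_rpow_of_nonpos (by positivity) ?_ (by linarith)
    rw [Real.norm_eq_abs, sq_abs]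
    nlinarith [min_le_left (δ ^ 2) 1, min_le_right (δ ^ 2) 1, sq_nonneg t]

lemma norm_cauchyKernel_sq_le {δ q : ℝ} (hδ : 0 < δ) (hq : 1 < q) {z : ℂ} (hz : δ ≤ z.im)
    (t : ℝ) : ‖cauchyKernel q z t‖ ^ 2 ≤ (δ ^ 2 + (t - z.re) ^ 2) ^ (-q) := by
  have h0 : ‖z - t‖ ^ 2 = z.im ^ 2 + (t - z.re) ^ 2 := by
    rw [← Complex.normSq_eq_norm_sq, Complex.normSq_apply]; simp; ring
  have h1 : 0 < z.im := hδ.trans_le hz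
  rw [norm_cauchyKernel, ← Real.rpow_natCast, ← Real.rpow_mul (norm_nonneg _), mul_comm,
    Real.rpow_mul (norm_nonneg _), Real.rpow_natCast]
  refine Real.rpow_le_rpow_of_nonpos (by positivity) ?_ (by linarith)
  rw [h0]; nlinarith

/-- A square-integrable function times a Cauchy kernel is dominated by an integrable function
whose integral does not depend on the real part of the point; this follows from
`2ab ≤ a² + b²`. -/
lemma norm_mul_cauchyKernel_le {δ q : ℝ} (hδ : 0 < δ) (hq : 1 < q) (f : ℝ → ℂ) {z : ℂ}
    (hz : δ ≤ z.im) (t : ℝ) :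
    ‖f t * cauchyKernel q z t‖ ≤ ‖f t‖ ^ 2 + (δ ^ 2 + (t - z.re) ^ 2) ^ (-q) := by
  rw [norm_mul]
  nlinarith [norm_cauchyKernel_sq_le hδ hq hz t, norm_nonneg (f t),
    norm_nonneg (cauchyKernel q z t), sq_nonneg (‖f t‖ - ‖cauchyKernel q z t‖)]

lemma integrable_majorant {δ q : ℝ} (hδ : 0 < δ) (hq : 1 < q) {f : ℝ → ℂ}
    (hf : MemLp f 2 volume) (x : ℝ) :
    Integrable fun t : ℝ => ‖f t‖ ^ 2 + (δ ^ 2 + (t - x) ^ 2) ^ (-q) :=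
  ((memLp_two_iff_integrable_sq_norm hf.1).1 hf).add
    ((integrable_rpow_const_add_sq hδ hq).comp_sub_right x)

lemma aestronglyMeasurable_mul_cauchyKernel (q : ℝ) {f : ℝ → ℂ} (hf : MemLp f 2 volume) {z : ℂ}
    (hz : 0 < z.im) : AEStronglyMeasurable (fun t => f t * cauchyKernel q z t) volume :=
  hf.1.mul (continuous_cauchyKernel q hz).aestronglyMeasurable

lemma integrable_mul_cauchyKernel {q : ℝ} (hq : 1 < q) {f : ℝ → ℂ}
    (hf : MemLp f 2 volume) {z : ℂ} (hz : 0 < z.im) :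
    Integrable fun t => f t * cauchyKernel q z t :=
  (integrable_majorant hz hq hf z.re).mono' (aestronglyMeasurable_mul_cauchyKernel q hf hz)
    (Filter.Eventually.of_forall fun t => norm_mul_cauchyKernel_le hz hq f le_rfl t)

lemma holExt_bounded {p : ℝ} (hp : 0 < p) {f : ℝ → ℂ} (hf : MemLp f 2 volume) {δ : ℝ}
    (hδ : 0 < δ) : ∃ C, ∀ z : ℂ, δ ≤ z.im → ‖holExt p f z‖ ≤ C := by
  refine ⟨‖((Real.Gamma (p + 1) / (2 * Real.pi) : ℝ) : ℂ)‖ *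
    ∫ t : ℝ, (‖f t‖ ^ 2 + (δ ^ 2 + t ^ 2) ^ (-(p + 1))), fun z hz => ?_⟩
  rw [holExt, norm_mul]
  refine mul_le_mul_of_nonneg_left ?_ (norm_nonneg _)
  have hi := integrable_majorant hδ (show 1 < p + 1 by linarith) hf
  refine (norm_integral_le_of_norm_le (hi z.re)
    (Filter.Eventually.of_forall fun t =>
      norm_mul_cauchyKernel_le hδ (by linarith) f hz t)).trans_eq ?_
  have h2 := (memLp_two_iff_integrable_sq_norm hf.1).1 hf
  have h3 := integrable_rpow_const_add_sq hδ (show 1 < p + 1 by linarith)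
  rw [integral_add h2 (h3.comp_sub_right z.re), integral_add h2 h3,
    integral_sub_right_eq_self (fun t : ℝ => (δ ^ 2 + t ^ 2) ^ (-(p + 1))) z.re]

lemma holExt_differentiableAt {p : ℝ} (hp : 0 < p) {f : ℝ → ℂ} (hf : MemLp f 2 volume) {z : ℂ}
    (hz : 0 < z.im) : DifferentiableAt ℂ (holExt p f) z := by
  refine DifferentiableAt.const_mul ?_ _
  have hball : ∀ w ∈ Metric.ball z (z.im / 2), z.im / 2 < w.im := fun w hw => by
    have := (Complex.abs_im_le_norm (w - z)).trans_lt (by simpa [dist_eq_norm] using hw)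
    rw [Complex.sub_im, abs_lt] at this
    linarith
  have hpos : ∀ w ∈ Metric.ball z (z.im / 2), 0 < w.im := fun w hw => by
    linarith [hball w hw]
  have hz2 : 0 < z.im / 2 := by linarith
  -- On the ball of radius `im z / 2` one has `|w - t| ≥ |z - t| / 2`, uniformly in `t`.
  have hbound : ∀ t : ℝ, ∀ w ∈ Metric.ball z (z.im / 2),
      ‖f t * (((-(p + 1) : ℝ) : ℂ) * cauchyKernel (p + 1 + 1) w t * -Complex.I)‖ ≤
        (p + 1) * (2⁻¹ : ℝ) ^ (-(p + 1 + 1)) * ‖f t * cauchyKernel (p + 1 + 1) z t‖ := by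
    intro t w hw
    have h1 : ‖z - t‖ * 2⁻¹ ≤ ‖w - t‖ := by
      have h2 : ‖z - w‖ < z.im / 2 := by
        rw [norm_sub_rev]; simpa [dist_eq_norm] using hw
      have h3 : z.im ≤ ‖z - t‖ := by
        have := (le_abs_self _).trans (Complex.abs_im_le_norm (z - t))
        simpa using this
      have h4 := norm_sub_le_norm_sub_add_norm_sub z w (t : ℂ)
      linarith
    have h0 : 0 < ‖z - t‖ := by
      refine norm_pos_iff.2 fun h => ?_
      have := congrArg Complex.im h
      simp at this; linarith
    have h5 : ‖w - t‖ ^ (-(p + 1 + 1)) ≤ ‖z - t‖ ^ (-(p + 1 + 1)) * (2⁻¹ : ℝ) ^ (-(p + 1 + 1)) := by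
      rw [← Real.mul_rpow h0.le (by norm_num)]
      exact Real.rpow_le_rpow_of_nonpos (by positivity) h1 (by linarith)
    simp only [norm_mul, norm_cauchyKernel, norm_neg, Complex.norm_I, mul_one, Complex.norm_real,
      Real.norm_eq_abs, abs_of_pos (show 0 < p + 1 by linarith)]
    calc ‖f t‖ * ((p + 1) * ‖w - t‖ ^ (-(p + 1 + 1)))
        ≤ ‖f t‖ * ((p + 1) * (‖z - t‖ ^ (-(p + 1 + 1)) * (2⁻¹ : ℝ) ^ (-(p + 1 + 1)))) := by
          gcongr
      _ = _ := by ring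
  have key := hasDerivAt_integral_of_dominated_loc_of_deriv_le
    (F := fun z t => f t * cauchyKernel (p + 1) z t)
    (F' := fun z t => f t * (((-(p + 1) : ℝ) : ℂ) * cauchyKernel (p + 1 + 1) z t * -Complex.I))
    (μ := volume) (x₀ := z) (s := Metric.ball z (z.im / 2))
    (Metric.ball_mem_nhds z hz2)
    (Filter.eventually_of_mem (Metric.ball_mem_nhds z hz2) fun w hw =>
      aestronglyMeasurable_mul_cauchyKernel _ hf (hpos w hw))
    (integrable_mul_cauchyKernel (by linarith) hf hz)
    (hf.1.mul (((continuous_cauchyKernel _ hz).const_mul _).mul_const _).aestronglyMeasurable)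
    (Filter.Eventually.of_forall hbound)
    ((integrable_mul_cauchyKernel (by linarith) hf hz).norm.const_mul _)
    (Filter.Eventually.of_forall fun t w hw =>
      (hasDerivAt_cauchyKernel (p + 1) (hpos w hw) t).const_mul (f t))
  exact key.2.differentiableAt

/-- The Laplace transform of `ω ^ p` at a complex point of the right half plane, obtained from its
value at real points by the identity theorem. -/
lemma integral_rpow_mul_cexp_neg_mul_Ioi {p : ℝ} (hp : 0 < p) {r : ℂ} (hr : 0 < r.re) :
    ∫ ω in Ioi (0 : ℝ), ((ω ^ p : ℝ) : ℂ) * Complex.exp (-(r * ω)) =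
      (Real.Gamma (p + 1) : ℂ) * r ^ ((-(p + 1) : ℝ) : ℂ) := by
  have hmajor : ∀ s : ℝ, 0 < s → ∀ q : ℝ, 0 < q →
      IntegrableOn (fun ω : ℝ => ω ^ q * Real.exp (-s * ω)) (Ioi 0) := fun s hs q hq => by
    have := integrableOn_rpow_mul_exp_neg_mul_rpow (p := 1) (s := q) (b := s) (by linarith)
      one_pos hs
    simpa using this
  have hmeas : ∀ z : ℂ, ∀ q : ℝ, AEStronglyMeasurable
      (fun ω : ℝ => ((ω ^ q : ℝ) : ℂ) * Complex.exp (-(z * ω))) (volume.restrict (Ioi 0)) :=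
    fun z q => by
      have : Measurable (fun ω : ℝ => ((ω ^ q : ℝ) : ℂ) * Complex.exp (-(z * ω))) := by fun_prop
      exact this.aestronglyMeasurable
  have hnorm : ∀ z : ℂ, ∀ ω : ℝ, 0 < ω → ∀ q : ℝ,
      ‖((ω ^ q : ℝ) : ℂ) * Complex.exp (-(z * ω))‖ = ω ^ q * Real.exp (-z.re * ω) :=
    fun z ω hω q => by
      rw [norm_mul, Complex.norm_real, Real.norm_of_nonneg (by positivity), Complex.norm_exp]
      simp
  have hopen : IsOpen {z : ℂ | 0 < z.re} := isOpen_lt continuous_const Complex.continuous_re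
  have hL : DifferentiableOn ℂ
      (fun z : ℂ => ∫ ω in Ioi (0 : ℝ), ((ω ^ p : ℝ) : ℂ) * Complex.exp (-(z * ω)))
      {z | 0 < z.re} := by
    intro z hz
    have hz' : 0 < z.re := hz
    have hball : ∀ w ∈ Metric.ball z (z.re / 2), z.re / 2 < w.re := fun w hw => by
      have := (Complex.abs_re_le_norm (w - z)).trans_lt (by simpa [dist_eq_norm] using hw)
      rw [Complex.sub_re, abs_lt] at this
      linarith
    have hz2 : 0 < z.re / 2 := by linarith
    have key := hasDerivAt_integral_of_dominated_loc_of_deriv_le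
      (F := fun z (ω : ℝ) => ((ω ^ p : ℝ) : ℂ) * Complex.exp (-(z * ω)))
      (F' := fun z (ω : ℝ) => ((ω ^ p : ℝ) : ℂ) * (Complex.exp (-(z * ω)) * -ω))
      (bound := fun ω => ω ^ (p + 1) * Real.exp (-(z.re / 2) * ω))
      (μ := volume.restrict (Ioi 0)) (x₀ := z) (s := Metric.ball z (z.re / 2))
      (Metric.ball_mem_nhds z hz2)
      (Filter.Eventually.of_forall fun w => hmeas w p)
      ((hmajor z.re hz' p hp).mono' (hmeas z p)
        ((ae_restrict_mem measurableSet_Ioi).mono fun ω hω => (hnorm z ω hω p).le))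
      (by
        have : Measurable fun ω : ℝ =>
          ((ω ^ p : ℝ) : ℂ) * (Complex.exp (-(z * ω)) * -ω) := by fun_prop
        exact this.aestronglyMeasurable)
      ((ae_restrict_mem measurableSet_Ioi).mono fun ω hω w hw => by
        have hω' : (0 : ℝ) < ω := hω
        rw [← mul_assoc, norm_mul, hnorm w ω hω', norm_neg, Complex.norm_real,
          Real.norm_of_nonneg hω'.le, Real.rpow_add_one hω'.ne', mul_right_comm]
        have := hball w hw
        gcongr)
      (hmajor (z.re / 2) hz2 (p + 1) (by linarith))
      (Filter.Eventually.of_forall fun ω w _ => by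
        have h1 : HasDerivAt (fun z : ℂ => -(z * ω)) (-ω : ℂ) w := by
          simpa using ((hasDerivAt_id' w).mul_const (ω : ℂ)).fun_neg
        exact h1.cexp.const_mul _)
    exact key.2.differentiableAt.differentiableWithinAt
  have hR : DifferentiableOn ℂ
      (fun z : ℂ => (Real.Gamma (p + 1) : ℂ) * z ^ ((-(p + 1) : ℝ) : ℂ)) {z | 0 < z.re} :=
    fun z hz => ((differentiableAt_id.cpow_const (Or.inl hz)).const_mul _).differentiableWithinAt
  have hreal : ∀ t : ℝ, 0 < t →
      ∫ ω in Ioi (0 : ℝ), ((ω ^ p : ℝ) : ℂ) * Complex.exp (-((t : ℂ) * ω)) =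
        (Real.Gamma (p + 1) : ℂ) * (t : ℂ) ^ ((-(p + 1) : ℝ) : ℂ) := fun t ht => by
    have h := Real.integral_rpow_mul_exp_neg_mul_Ioi (a := p + 1) (by linarith) ht
    rw [← Complex.ofReal_cpow ht.le, Real.rpow_neg ht.le, ← Real.inv_rpow ht.le, ← one_div,
      mul_comm, ← Complex.ofReal_mul, ← h, ← integral_complex_ofReal]
    simp
  have hconv : IsPreconnected {z : ℂ | 0 < z.re} :=
    (convex_halfSpace_re_gt 0).isPreconnected
  refine (hL.analyticOnNhd hopen).eqOn_of_preconnected_of_frequently_eq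
    (hR.analyticOnNhd hopen) hconv (z₀ := 1) (by simp) ?_ hr
  have htend : Filter.Tendsto (fun t : ℝ => (t : ℂ)) (nhdsWithin 1 {1}ᶜ) (nhdsWithin 1 {1}ᶜ) := by
    refine tendsto_nhdsWithin_iff.2 ⟨?_, ?_⟩
    · exact (Complex.continuous_ofReal.tendsto' 1 1 (by simp)).mono_left nhdsWithin_le_nhds
    · filter_upwards [self_mem_nhdsWithin] with t ht
      simpa using ht
  refine htend.frequently (Filter.Eventually.frequently ?_)
  filter_upwards [nhdsWithin_le_nhds (lt_mem_nhds (show (0 : ℝ) < 1 by norm_num))] with t ht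
  exact hreal t ht

lemma psi_eq {p : ℝ} (hp : 0 < p) (x : ℝ) :
    psi p x = ((Real.Gamma (p + 1) / (2 * Real.pi) : ℝ) : ℂ) *
      (1 - Complex.I * x) ^ ((-(p + 1) : ℝ) : ℂ) := by
  have h2 : ∫ ω in Ioi (0 : ℝ), ((ω ^ p * Real.exp (-ω) : ℝ) : ℂ) * Complex.exp (Complex.I * ω * x)
      = ∫ ω in Ioi (0 : ℝ), ((ω ^ p : ℝ) : ℂ) * Complex.exp (-((1 - Complex.I * x) * ω)) := by
    congr 1; ext ω
    rw [Complex.ofReal_mul, Complex.ofReal_exp, mul_assoc, ← Complex.exp_add]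
    congr 2
    push_cast; ring
  rw [psi, h2, integral_rpow_mul_cexp_neg_mul_Ioi hp (by simp)]
  push_cast; ring

lemma ofReal_mul_cpow {r : ℝ} (hr : 0 < r) {w : ℂ} (hw : w ≠ 0) (s : ℂ) :
    ((r : ℂ) * w) ^ s = (r : ℂ) ^ s * w ^ s := by
  have hr' : (r : ℂ) ≠ 0 := by exact_mod_cast hr.ne'
  rw [Complex.cpow_def_of_ne_zero (mul_ne_zero hr' hw), Complex.cpow_def_of_ne_zero hr',
    Complex.cpow_def_of_ne_zero hw, Complex.log_ofReal_mul hr hw, Complex.ofReal_log hr.le,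
    add_mul, Complex.exp_add]

lemma psiDil_eq {a p : ℝ} (ha : 0 < a) (hp : 0 < p) (l x t : ℝ) :
    psiDil a p l (x - t) = ((a ^ (p * l) : ℝ) : ℂ) *
      (((Real.Gamma (p + 1) / (2 * Real.pi) : ℝ) : ℂ) *
        cauchyKernel (p + 1) (x + (a ^ l : ℝ) * Complex.I) t) := by
  have hal : 0 < a ^ l := Real.rpow_pos_of_pos ha l
  have hw : (1 - Complex.I * ((a ^ (-l) * (x - t) : ℝ) : ℂ)) ≠ 0 := fun h => by
    have := congrArg Complex.re h
    simp at this
  have h1 : -(Complex.I * ((x + (a ^ l : ℝ) * Complex.I : ℂ) - t))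
      = ((a ^ l : ℝ) : ℂ) * (1 - Complex.I * ((a ^ (-l) * (x - t) : ℝ) : ℂ)) := by
    have h2 : ((a ^ l : ℝ) : ℂ) * ((a ^ (-l) : ℝ) : ℂ) = 1 := by
      rw [← Complex.ofReal_mul, Real.rpow_neg ha.le, mul_inv_cancel₀ hal.ne', Complex.ofReal_one]
    push_cast at h2 ⊢
    linear_combination (-((a ^ l : ℝ) : ℂ)) * Complex.I_sq + Complex.I * (x - t) * h2
  rw [psiDil, psi_eq hp, cauchyKernel, h1, ofReal_mul_cpow hal hw, ← Complex.ofReal_cpow hal.le,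
    ← Real.rpow_mul ha.le]
  have h3 : (a ^ (-l) : ℝ) = a ^ (p * l) * a ^ (l * -(p + 1)) := by
    rw [← Real.rpow_add ha]; congr 1; ring
  rw [h3]
  push_cast; ring

/-- The wavelet transform at scale `l` is the restriction of a holomorphic function to the line
`im z = a ^ l`, multiplied by `a ^ (p l)`. -/
lemma wt_eq {a p : ℝ} (ha : 0 < a) (hp : 0 < p) (f : ℝ → ℂ) (l x : ℝ) :
    wt a p f l x = ((a ^ (p * l) : ℝ) : ℂ) * holExt p f (x + (a ^ l : ℝ) * Complex.I) := by
  simp only [wt, convolution, ContinuousLinearMap.mul_apply', holExt, psiDil_eq ha hp,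
    ← integral_const_mul]
  congr 1; ext t; ring

end CauchyWavelet

/-! ### Suprema and products on horizontal lines -/

namespace CauchyWavelet

/-- A pair of holomorphic functions on the upper half plane, each bounded on every half plane
`im z ≥ δ > 0`. -/
structure IsHalfPlanePair (F : Fin 2 → ℂ → ℂ) : Prop where
  differentiableAt : ∀ s z, 0 < z.im → DifferentiableAt ℂ (F s) z
  bounded : ∀ δ : ℝ, 0 < δ → ∃ C, ∀ s z, δ ≤ z.im → ‖F s z‖ ≤ C

/-- The supremum of both functions of the pair over the horizontal line at height `y`. -/
noncomputable def lineSup (F : Fin 2 → ℂ → ℂ) (y : ℝ) : ℝ :=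
  ⨆ q : Fin 2 × ℝ, ‖F q.1 (q.2 + y * Complex.I)‖

/-- The difference, between the two functions of the pair, of the products
`F (x + i v) * conj (F (x + i w))`. -/
noncomputable def crossDiff (F : Fin 2 → ℂ → ℂ) (v w x : ℝ) : ℂ :=
  F 0 (x + v * Complex.I) * conj (F 0 (x + w * Complex.I)) -
    F 1 (x + v * Complex.I) * conj (F 1 (x + w * Complex.I))

/-- The holomorphic function on the strip `|im z| < m` whose values at `x + i β` are the
differences `crossDiff F (m + β) (m - β) x`. -/
noncomputable def crossHol (F : Fin 2 → ℂ → ℂ) (m : ℝ) (z : ℂ) : ℂ :=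
  F 0 (z + m * Complex.I) * conj (F 0 (conj z + m * Complex.I)) -
    F 1 (z + m * Complex.I) * conj (F 1 (conj z + m * Complex.I))

lemma crossHol_apply (F : Fin 2 → ℂ → ℂ) (m x β : ℝ) :
    crossHol F m (x + β * Complex.I) = crossDiff F (m + β) (m - β) x := by
  have h1 : (x + β * Complex.I + m * Complex.I : ℂ) = x + ((m + β : ℝ) : ℂ) * Complex.I := by
    push_cast; ring
  have h2 : (conj (x + β * Complex.I : ℂ) + m * Complex.I : ℂ)
      = x + ((m - β : ℝ) : ℂ) * Complex.I := by
    simp; ring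
  rw [crossHol, crossDiff, h1, h2]

lemma norm_crossDiff_swap (F : Fin 2 → ℂ → ℂ) (v w x : ℝ) :
    ‖crossDiff F w v x‖ = ‖crossDiff F v w x‖ := by
  rw [← RCLike.norm_conj]
  congr 1
  simp only [crossDiff, map_sub, map_mul, Complex.conj_conj]
  ring

lemma lineSup_nonneg (F : Fin 2 → ℂ → ℂ) (y : ℝ) : 0 ≤ lineSup F y :=
  Real.iSup_nonneg fun _ => norm_nonneg _

lemma differentiableAt_mul_conj {f g : ℂ → ℂ} {c d z : ℂ} (hf : DifferentiableAt ℂ f (z + c))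
    (hg : DifferentiableAt ℂ g (conj z + d)) :
    DifferentiableAt ℂ (fun z => f (z + c) * conj (g (conj z + d))) z := by
  have h1 : DifferentiableAt ℂ (fun z => f (z + c)) z := hf.comp z (by fun_prop)
  have h2 : DifferentiableAt ℂ (fun z => g (z + d)) (conj z) := by
    exact DifferentiableAt.comp (conj z) hg (by fun_prop)
  have h3 := h2.conj_conj
  rw [Complex.conj_conj] at h3
  exact h1.mul h3

/-- Maximum principle on a rectangle, in comparison with the modulus `B * exp (re g)` of a
holomorphic function without zeros. -/
lemma norm_le_mul_exp_of_rectangle {H g : ℂ → ℂ} {X y₀ y₁ B : ℝ} (hX : 0 < X) (hy : y₀ < y₁)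
    (hH : ∀ z : ℂ, y₀ ≤ z.im → z.im ≤ y₁ → DifferentiableAt ℂ H z) (hg : Differentiable ℂ g)
    (hside : ∀ x y : ℝ, |x| = X → y₀ ≤ y → y ≤ y₁ →
      ‖H (x + y * Complex.I)‖ ≤ B * Real.exp (g (x + y * Complex.I)).re)
    (hbot : ∀ x : ℝ, |x| ≤ X →
      ‖H (x + y₀ * Complex.I)‖ ≤ B * Real.exp (g (x + y₀ * Complex.I)).re)
    (htop : ∀ x : ℝ, |x| ≤ X →
      ‖H (x + y₁ * Complex.I)‖ ≤ B * Real.exp (g (x + y₁ * Complex.I)).re)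
    {x y : ℝ} (hx : |x| ≤ X) (hy₀ : y₀ ≤ y) (hy₁ : y ≤ y₁) :
    ‖H (x + y * Complex.I)‖ ≤ B * Real.exp (g (x + y * Complex.I)).re := by
  have hmul : ∀ z : ℂ, ‖H z‖ ≤ B * Real.exp (g z).re ↔ ‖H z * Complex.exp (-g z)‖ ≤ B := by
    intro z
    rw [norm_mul, Complex.norm_exp, Complex.neg_re, Real.exp_neg, ← div_eq_mul_inv,
      div_le_iff₀ (Real.exp_pos _)]
  have hcl : closure (Ioo (-X) X ×ℂ Ioo y₀ y₁) = Icc (-X) X ×ℂ Icc y₀ y₁ := by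
    rw [Complex.closure_reProdIm, closure_Ioo (by linarith), closure_Ioo hy.ne]
  rw [hmul]
  refine Complex.norm_le_of_forall_mem_frontier_norm_le (U := Ioo (-X) X ×ℂ Ioo y₀ y₁)
    (f := fun z => H z * Complex.exp (-g z))
    (Bornology.IsBounded.reProdIm (Metric.isBounded_Ioo _ _) (Metric.isBounded_Ioo _ _)) ?_ ?_ ?_
  · refine DifferentiableOn.diffContOnCl fun z hz => ?_
    rw [hcl] at hz
    exact ((hH z hz.2.1 hz.2.2).mul (hg z).neg.cexp).differentiableWithinAt
  · intro z hz
    rw [Complex.frontier_reProdIm, closure_Ioo (by linarith), closure_Ioo hy.ne,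
      frontier_Ioo hy, frontier_Ioo (by linarith)] at hz
    rw [← hmul, ← Complex.re_add_im z]
    rcases hz with ⟨h1, h2⟩ | ⟨h1, h2⟩
    · have h1' := abs_le.2 ⟨h1.1, h1.2⟩
      rcases h2 with h2 | h2
      · rw [h2]; exact hbot _ h1'
      · rw [mem_singleton_iff.1 h2]; exact htop _ h1'
    · refine hside _ _ ?_ h2.1 h2.2
      rcases h1 with h1 | h1
      · rw [h1, abs_neg, abs_of_pos hX]
      · rw [mem_singleton_iff.1 h1, abs_of_pos hX]
  · rw [hcl]
    exact ⟨by simpa using abs_le.1 hx, by simpa using ⟨hy₀, hy₁⟩⟩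

namespace IsHalfPlanePair

variable {F : Fin 2 → ℂ → ℂ} (hF : IsHalfPlanePair F)
include hF

lemma norm_le_lineSup {y : ℝ} (hy : 0 < y) (s : Fin 2) (x : ℝ) :
    ‖F s (x + y * Complex.I)‖ ≤ lineSup F y := by
  obtain ⟨C, hC⟩ := hF.bounded y hy
  refine le_ciSup (f := fun q : Fin 2 × ℝ => ‖F q.1 (q.2 + y * Complex.I)‖) ?_ (s, x)
  exact ⟨C, by rintro _ ⟨q, rfl⟩; exact hC _ _ (by simp)⟩

lemma norm_le_lineSup_im (s : Fin 2) {z : ℂ} (hz : 0 < z.im) : ‖F s z‖ ≤ lineSup F z.im := by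
  have := hF.norm_le_lineSup hz s z.re
  rwa [Complex.re_add_im] at this

lemma lineSup_antitone {y y' : ℝ} (hy : 0 < y) (hyy' : y ≤ y') :
    lineSup F y' ≤ lineSup F y := by
  refine ciSup_le fun q => ?_
  obtain ⟨C, hC⟩ := hF.bounded y hy
  -- the half plane `im > y` is rotated onto the right half plane
  have him : ∀ z : ℂ, (q.2 + Complex.I * (y + z) : ℂ).im = y + z.re := fun z => by simp
  have key := PhragmenLindelof.right_half_plane_of_bounded_on_real
    (f := fun z : ℂ => F q.1 (q.2 + Complex.I * (y + z))) (C := lineSup F y)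
    (z := ((y' - y : ℝ) : ℂ)) ?_ ⟨0, by norm_num, 0, ?_⟩ ?_ ?_ (by simpa using hyy')
  · have h : (q.2 + y' * Complex.I : ℂ) = q.2 + Complex.I * (y + ((y' - y : ℝ) : ℂ)) := by
      push_cast; ring
    rw [h]
    exact key
  · refine DifferentiableOn.diffContOnCl fun z hz => ?_
    rw [Complex.closure_setOfPred_lt_re] at hz
    have hz' : 0 ≤ z.re := hz
    refine DifferentiableAt.differentiableWithinAt ?_
    refine DifferentiableAt.comp z (hF.differentiableAt q.1 _ ?_) (by fun_prop)
    rw [him]; linarith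
  · simp only [zero_mul, Real.exp_zero]
    refine Asymptotics.IsBigO.of_bound C ?_
    refine Filter.eventually_inf_principal.2 (Filter.Eventually.of_forall fun z hz => ?_)
    have hz' : 0 < z.re := hz
    simpa using hC q.1 _ (by rw [him]; linarith)
  · refine ⟨C, Filter.eventually_map.2 ?_⟩
    filter_upwards [Filter.eventually_ge_atTop 0] with x hx
    exact hC q.1 _ (by rw [him]; simpa using hx)
  · intro x
    have h : (q.2 + Complex.I * (y + x * Complex.I) : ℂ) =
        ((q.2 - x : ℝ) : ℂ) + y * Complex.I := by
      push_cast; linear_combination (x : ℂ) * Complex.I_sq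
    change ‖F q.1 (q.2 + Complex.I * (y + x * Complex.I))‖ ≤ _
    rw [h]
    exact hF.norm_le_lineSup hy _ _

/-- For pairs of heights with a common midpoint, the product of the suprema grows with the
distance between the heights: the product `F (x + i v) * conj (F (x' + i w))` extends to a bounded
holomorphic function of the half distance on a strip. -/
lemma lineSup_mul_le {v w v' w' : ℝ} (hsum : v + w = v' + w') (hw' : 0 < w') (hw : w' ≤ w)
    (hv : w' ≤ v) : lineSup F v * lineSup F w ≤ lineSup F v' * lineSup F w' := by
  have hkey : ∀ (s r : Fin 2) (x₀ x₁ : ℝ),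
      ‖F s (x₀ + v * Complex.I)‖ * ‖F r (x₁ + w * Complex.I)‖ ≤ lineSup F v' * lineSup F w' := by
    intro s r x₀ x₁
    set m := (v + w) / 2 with hm
    have hv' : v' = m + (m - w') := by rw [hm]; linarith
    have him₁ : ∀ z : ℂ, (z + (x₀ + m * Complex.I) : ℂ).im = m + z.im := fun z => by
      simp; ring
    have him₂ : ∀ z : ℂ, (conj z + (x₁ + m * Complex.I) : ℂ).im = m - z.im := fun z => by
      simp; ring
    obtain ⟨C, hC⟩ := hF.bounded w' hw'
    have key := PhragmenLindelof.horizontal_strip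
      (f := fun z : ℂ =>
        F s (z + (x₀ + m * Complex.I)) * conj (F r (conj z + (x₁ + m * Complex.I))))
      (a := -(m - w')) (b := m - w') (C := lineSup F v' * lineSup F w')
      (z := ((v - m : ℝ) : ℂ) * Complex.I)
    rcases eq_or_lt_of_le (show w' ≤ m by linarith) with hlt | hlt
    · have h1 : v = w' := by linarith
      have h2 : w = w' := by linarith
      have h3 : v' = w' := by linarith
      rw [h1, h2, h3]
      exact mul_le_mul (hF.norm_le_lineSup hw' _ _) (hF.norm_le_lineSup hw' _ _) (norm_nonneg _)
        (lineSup_nonneg _ _)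
    · convert key ?_ ⟨0, by apply div_pos Real.pi_pos; linarith, 0, ?_⟩ ?_ ?_ ?_ ?_ using 1
      · rw [norm_mul, RCLike.norm_conj]
        congr 3
        · push_cast; ring
        · simp only [map_mul, Complex.conj_ofReal, Complex.conj_I, hm]; push_cast; ring
      · refine DifferentiableOn.diffContOnCl fun z hz => ?_
        have hz' : z.im ∈ Icc (-(m - w')) (m - w') := by
          rw [← closure_Ioo (by linarith)]
          exact (Complex.continuous_im.closure_preimage_subset _) hz
        refine (differentiableAt_mul_conj (hF.differentiableAt s _ ?_)
          (hF.differentiableAt r _ ?_)).differentiableWithinAt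
        · rw [him₁]; linarith [hz'.1]
        · rw [him₂]; linarith [hz'.2]
      · simp only [zero_mul, Real.exp_zero]
        refine Asymptotics.IsBigO.of_bound (C * C) ?_
        refine Filter.eventually_inf_principal.2 (Filter.Eventually.of_forall fun z hz => ?_)
        have hz' : z.im ∈ Ioo (-(m - w')) (m - w') := hz
        have h1 := hC s (z + (x₀ + m * Complex.I)) (by rw [him₁]; linarith [hz'.1])
        have h2 := hC r (conj z + (x₁ + m * Complex.I)) (by rw [him₂]; linarith [hz'.2])
        rw [norm_mul, RCLike.norm_conj, norm_one, mul_one]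
        exact mul_le_mul h1 h2 (norm_nonneg _) ((norm_nonneg _).trans h1)
      · intro z hz
        have h1 := hF.norm_le_lineSup_im s (z := z + (x₀ + m * Complex.I))
          (by rw [him₁, hz]; linarith)
        have h2 := hF.norm_le_lineSup_im r (z := conj z + (x₁ + m * Complex.I))
          (by rw [him₂, hz]; linarith)
        rw [him₁, hz, show m + -(m - w') = w' by ring] at h1
        rw [him₂, hz, show m - -(m - w') = v' by linarith] at h2
        rw [norm_mul, RCLike.norm_conj, mul_comm]
        exact mul_le_mul h2 h1 (norm_nonneg _) (lineSup_nonneg _ _)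
      · intro z hz
        have h1 := hF.norm_le_lineSup_im s (z := z + (x₀ + m * Complex.I))
          (by rw [him₁, hz]; linarith)
        have h2 := hF.norm_le_lineSup_im r (z := conj z + (x₁ + m * Complex.I))
          (by rw [him₂, hz]; linarith)
        rw [him₁, hz, ← hv'] at h1
        rw [him₂, hz, show m - (m - w') = w' by ring] at h2
        rw [norm_mul, RCLike.norm_conj]
        exact mul_le_mul h1 h2 (norm_nonneg _) (lineSup_nonneg _ _)
      · simp; linarith
      · simp; linarith
  unfold lineSup at hkey ⊢
  rw [Real.iSup_mul_of_nonneg (Real.iSup_nonneg fun _ => norm_nonneg _)]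
  refine ciSup_le fun q => ?_
  rw [Real.mul_iSup_of_nonneg (norm_nonneg _)]
  exact ciSup_le fun q' => hkey _ _ _ _

lemma norm_crossDiff_le {v w : ℝ} (hv : 0 < v) (hw : 0 < w) (x : ℝ) :
    ‖crossDiff F v w x‖ ≤ 2 * (lineSup F v * lineSup F w) := by
  have h : ∀ s, ‖F s (x + v * Complex.I) * conj (F s (x + w * Complex.I))‖
      ≤ lineSup F v * lineSup F w := fun s => by
    rw [norm_mul, RCLike.norm_conj]
    exact mul_le_mul (hF.norm_le_lineSup hv s x) (hF.norm_le_lineSup hw s x) (norm_nonneg _)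
      (lineSup_nonneg _ _)
  refine (norm_sub_le _ _).trans ?_
  linarith [h 0, h 1]

lemma differentiableAt_crossHol {m : ℝ} {z : ℂ} (h₁ : 0 < m + z.im) (h₂ : 0 < m - z.im) :
    DifferentiableAt ℂ (crossHol F m) z := by
  have h : ∀ s, DifferentiableAt ℂ
      (fun z : ℂ => F s (z + m * Complex.I) * conj (F s (conj z + m * Complex.I))) z := fun s =>
    differentiableAt_mul_conj (hF.differentiableAt s _ (by simp; linarith))
      (hF.differentiableAt s _ (by simp; linarith))
  exact (h 0).sub (h 1)

end IsHalfPlanePair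
end CauchyWavelet

/-! ### Maximum principles for products on two lines -/

namespace CauchyWavelet

/-- The quotient `cosh (l x) / cosh (l X)`: the loss in the exponent of `ε` at abscissa `x` when
estimates are only available for `|x| ≤ X`. It equals `1` at `|x| = X`. -/
noncomputable def edgeLoss (l X x : ℝ) : ℝ := Real.cosh (l * x) / Real.cosh (l * X)

lemma edgeLoss_pos (l X x : ℝ) : 0 < edgeLoss l X x :=
  div_pos (Real.cosh_pos _) (Real.cosh_pos _)

lemma edgeLoss_of_abs_eq (l : ℝ) {X x : ℝ} (hX : 0 < X) (hx : |x| = X) : edgeLoss l X x = 1 := by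
  have h : Real.cosh (l * x) = Real.cosh (l * X) := by
    rcases (abs_eq hX.le).1 hx with h | h
    · rw [h]
    · rw [h, mul_neg, Real.cosh_neg]
  rw [edgeLoss, h, div_self (Real.cosh_pos _).ne']

lemma re_cosh_div (l X x y : ℝ) :
    (Complex.cosh (l * (x + y * Complex.I)) / (Real.cosh (l * X) : ℝ)).re =
      edgeLoss l X x * Real.cos (l * y) := by
  have h : (l * (x + y * Complex.I) : ℂ) = ((l * x : ℝ) : ℂ) + ((l * y : ℝ) : ℂ) * Complex.I := by
    push_cast; ring
  rw [h, Complex.div_ofReal_re, Complex.cosh_add, Complex.cosh_mul_I, Complex.sinh_mul_I,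
    ← Complex.ofReal_cosh, ← Complex.ofReal_sinh, ← Complex.ofReal_cos, ← Complex.ofReal_sin,
    edgeLoss]
  simp only [Complex.add_re, Complex.mul_re, Complex.mul_im, Complex.ofReal_re, Complex.ofReal_im,
    Complex.I_re, Complex.I_im]
  ring

/-- This follows from `cosh (u / 2) / cosh u ≤ q + q ^ 3` with `q = e^{-u/2}`, `u = l X`. -/
lemma edgeLoss_le_of_abs_le_half {l X x : ℝ} (hl : 0 < l) (hX : 0 < X) (hx : |x| ≤ X / 2) :
    edgeLoss l X x ≤ Real.exp (-(l * X / 2)) / (1 - Real.exp (-(l * X / 2))) := by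
  set q := Real.exp (-(l * X / 2)) with hq
  have hq0 : 0 < q := Real.exp_pos _
  have hq1 : q < 1 := Real.exp_lt_one_iff.2 (by have := mul_pos hl hX; linarith)
  have h1 : Real.cosh (l * x) ≤ Real.cosh (l * X / 2) := by
    rw [Real.cosh_le_cosh, abs_mul, abs_of_pos hl,
      abs_of_pos (show 0 < l * X / 2 by have := mul_pos hl hX; linarith), mul_div_assoc]
    exact mul_le_mul_of_nonneg_left hx hl.le
  have h2 : Real.cosh (l * X / 2) = (q⁻¹ + q) / 2 := by
    rw [Real.cosh_eq, hq, ← Real.exp_neg, neg_neg]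
  have h3 : q⁻¹ ^ 2 / 2 ≤ Real.cosh (l * X) := by
    rw [Real.cosh_eq, hq, ← Real.exp_neg, ← Real.exp_nat_mul]
    have := Real.exp_pos (-(l * X))
    rw [show ((2 : ℕ) : ℝ) * (- -(l * X / 2)) = l * X by push_cast; ring]
    linarith
  calc edgeLoss l X x ≤ ((q⁻¹ + q) / 2) / (q⁻¹ ^ 2 / 2) := by
        rw [edgeLoss]
        exact div_le_div₀ (by positivity) (h2 ▸ h1) (by positivity) h3
    _ = q + q ^ 3 := by field_simp
    _ ≤ q / (1 - q) := by
        rw [le_div_iff₀ (by linarith)]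
        have : 0 < q ^ 2 * (1 - q) + q ^ 4 := by
          have := sub_pos.2 hq1
          positivity
        nlinarith

/-- If the products at `u, w` and at `v, u` nearly agree and the modulus at `u` nearly agrees and is
bounded below, then the products at `v, w` nearly agree. -/
lemma norm_sub_le_of_common_factor {a₁ a₂ u₁ u₂ w₁ w₂ : ℂ} {A U W P Q ε r : ℝ} (hU : 0 < U)
    (hr : 0 < r) (hW : 0 ≤ W) (hA : 0 ≤ A) (ha₂ : ‖a₂‖ ≤ A) (hw₁ : ‖w₁‖ ≤ W)
    (hu₁ : r * U ≤ ‖u₁‖) (hu₂ : r * U ≤ ‖u₂‖)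
    (hP : ‖a₁ * conj u₁ - a₂ * conj u₂‖ ≤ P) (hQ : ‖u₁ * conj w₁ - u₂ * conj w₂‖ ≤ Q)
    (hε : |‖u₁‖ ^ 2 - ‖u₂‖ ^ 2| ≤ ε * U ^ 2) :
    ‖a₁ * conj w₁ - a₂ * conj w₂‖ ≤ P * (W / (r * U)) + A / (r * U) * Q + ε * (A * W) / r ^ 2 := by
  have hrU : 0 < r * U := mul_pos hr hU
  have h1 : 0 < ‖u₁‖ := hrU.trans_le hu₁
  have h2 : 0 < ‖u₂‖ := hrU.trans_le hu₂
  have hc1 : conj u₁ ≠ 0 := by simpa using norm_pos_iff.1 h1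
  have hc2 : u₂ ≠ 0 := norm_pos_iff.1 h2
  have hid : a₁ * conj w₁ - a₂ * conj w₂ =
      (a₁ * conj u₁ - a₂ * conj u₂) * (conj w₁ / conj u₁) +
        a₂ / u₂ * (u₁ * conj w₁ - u₂ * conj w₂) +
        a₂ * conj w₁ / (conj u₁ * u₂) * (u₂ * conj u₂ - u₁ * conj u₁) := by
    field_simp; ring
  have hP0 : 0 ≤ P := (norm_nonneg _).trans hP
  have hQ0 : 0 ≤ Q := (norm_nonneg _).trans hQ
  have hsq : ‖u₂ * conj u₂ - u₁ * conj u₁‖ ≤ ε * U ^ 2 := by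
    rw [Complex.mul_conj', Complex.mul_conj', ← Complex.ofReal_pow, ← Complex.ofReal_pow,
      ← Complex.ofReal_sub, Complex.norm_real, Real.norm_eq_abs, abs_sub_comm]
    exact hε
  rw [hid]
  refine (norm_add₃_le).trans (add_le_add_three ?_ ?_ ?_)
  · rw [norm_mul, norm_div, RCLike.norm_conj, RCLike.norm_conj]
    gcongr
  · rw [norm_mul, norm_div]
    gcongr
  · rw [norm_mul, norm_div, norm_mul, norm_mul, RCLike.norm_conj, RCLike.norm_conj]
    calc ‖a₂‖ * ‖w₁‖ / (‖u₁‖ * ‖u₂‖) * ‖u₂ * conj u₂ - u₁ * conj u₁‖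
        ≤ A * W / ((r * U) * (r * U)) * (ε * U ^ 2) := by gcongr
      _ = ε * (A * W) / r ^ 2 := by field_simp

namespace IsHalfPlanePair

variable {F : Fin 2 → ℂ → ℂ} (hF : IsHalfPlanePair F)
include hF

/-- Closeness of the moduli on the line `im z = α` propagates to closeness of the products at
`α + β` and `α - β`. The comparison function is `B * ε ^ (1 + i z / h - cosh (l z) / cosh (l X))`:
the last term absorbs the vertical sides, where only the trivial bound holds, because
`cos (l y) ≥ 1 - y / h`. -/
lemma norm_crossDiff_le_of_modulus {ε l X α h β : ℝ} (hε : ε ∈ Ioo (0 : ℝ) 1) (hl : 0 < l)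
    (hX : 0 < X) (hh : 0 < h) (hα : h < α) (hlh : l * h ≤ Real.pi / 2)
    (hmod : ∀ x : ℝ, |x| ≤ X →
      |‖F 0 (x + α * Complex.I)‖ ^ 2 - ‖F 1 (x + α * Complex.I)‖ ^ 2| ≤ ε * lineSup F α ^ 2)
    (hβ₀ : 0 ≤ β) (hβ : β ≤ h) {x : ℝ} (hx : |x| ≤ X) :
    ‖crossDiff F (α + β) (α - β) x‖ ≤
      2 * (lineSup F (α + β) * lineSup F (α - h)) * ε ^ (1 - β / h - edgeLoss l X x) := by
  obtain ⟨hε0, hε1⟩ := hε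
  -- By nestedness and monotonicity this bounds the products at all heights `α ± y`, `0 ≤ y ≤ h`.
  set B := 2 * (lineSup F (α + β) * lineSup F (α - h)) with hB
  have hB0 : 0 ≤ B := by
    have := mul_nonneg (lineSup_nonneg F (α + β)) (lineSup_nonneg F (α - h))
    linarith
  have hanti : lineSup F (α + h) ≤ lineSup F (α + β) :=
    hF.lineSup_antitone (by linarith) (by linarith)
  have hle : ∀ y : ℝ, 0 ≤ y → y ≤ h → 2 * (lineSup F (α + y) * lineSup F (α - y)) ≤ B :=
    fun y hy0 hyh => by
      have h1 := hF.lineSup_mul_le (v := α + y) (w := α - y) (v' := α + h) (w' := α - h)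
        (by ring) (by linarith) (by linarith) (by linarith)
      have h2 := mul_le_mul_of_nonneg_right hanti (lineSup_nonneg F (α - h))
      linarith
  set g : ℂ → ℂ := fun z => Real.log ε *
    (1 + Complex.I * z / h - Complex.cosh (l * z) / (Real.cosh (l * X) : ℝ)) with hg
  have hre : ∀ x y : ℝ, Real.exp (g (x + y * Complex.I)).re =
      ε ^ (1 - y / h - edgeLoss l X x * Real.cos (l * y)) := fun x y => by
    rw [Real.rpow_def_of_pos hε0]
    congr 1
    simp only [hg]
    rw [Complex.re_ofReal_mul, Complex.sub_re, re_cosh_div, Complex.add_re, Complex.div_ofReal_re]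
    simp; left; ring
  have hcos : ∀ y : ℝ, 0 ≤ y → y ≤ h → 1 - y / h ≤ Real.cos (l * y) := fun y hy0 hyh => by
    have h1 : l * y ≤ Real.pi / 2 := by nlinarith
    refine le_trans ?_ (Real.one_sub_mul_le_cos (by positivity) h1)
    have h2 : 2 / Real.pi * (l * y) ≤ y / h := by
      rw [div_mul_eq_mul_div, div_le_div_iff₀ Real.pi_pos hh]
      nlinarith
    linarith
  have hone : ∀ e : ℝ, e ≤ 0 → B ≤ B * ε ^ e := fun e he =>
    le_mul_of_one_le_right hB0 (Real.one_le_rpow_of_pos_of_le_one_of_nonpos hε0 hε1.le he)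
  have key := norm_le_mul_exp_of_rectangle (H := crossHol F α) (g := g) (X := X) (y₀ := 0)
    (y₁ := h) (B := B) hX hh
    (fun z hz0 hz1 => hF.differentiableAt_crossHol (by linarith) (by linarith))
    (by rw [hg]; fun_prop) ?_ ?_ ?_ hx hβ₀ hβ
  · rw [hre, crossHol_apply] at key
    refine key.trans (mul_le_mul_of_nonneg_left ?_ hB0)
    refine Real.rpow_le_rpow_of_exponent_ge hε0 hε1.le ?_
    nlinarith [Real.cos_le_one (l * β), edgeLoss_pos l X x]
  · intro x y hx hy0 hyh
    rw [hre, crossHol_apply, edgeLoss_of_abs_eq l hX hx, one_mul]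
    refine (hF.norm_crossDiff_le (by linarith) (by linarith) x).trans
      ((hle y hy0 hyh).trans (hone _ ?_))
    linarith [hcos y hy0 hyh]
  · intro x hx
    rw [hre, crossHol_apply]
    have h1 : ‖crossDiff F (α + 0) (α - 0) x‖ ≤ ε * lineSup F α ^ 2 := by
      rw [add_zero, sub_zero, crossDiff, Complex.mul_conj', Complex.mul_conj',
        ← Complex.ofReal_pow, ← Complex.ofReal_pow, ← Complex.ofReal_sub, Complex.norm_real]
      exact hmod x hx
    have h2 : lineSup F α ^ 2 ≤ B := by
      have := hle 0 le_rfl hh.le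
      rw [add_zero, sub_zero] at this
      nlinarith [sq_nonneg (lineSup F α)]
    have h3 : ε ≤ ε ^ (1 - 0 / h - edgeLoss l X x * Real.cos (l * 0)) := by
      conv_lhs => rw [← Real.rpow_one ε]
      refine Real.rpow_le_rpow_of_exponent_ge hε0 hε1.le ?_
      simpa using (edgeLoss_pos l X x).le
    refine h1.trans ?_
    rw [mul_comm B]
    exact mul_le_mul h3 h2 (sq_nonneg _) (by positivity)
  · intro x _
    rw [hre, crossHol_apply]
    refine (hF.norm_crossDiff_le (by linarith) (by linarith) x).trans
      ((hle h hh.le le_rfl).trans (hone _ ?_))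
    rw [div_self hh.ne', sub_self, zero_sub, neg_nonpos]
    exact mul_nonneg (edgeLoss_pos l X x).le
      (Real.cos_nonneg_of_mem_Icc ⟨by linarith [Real.pi_pos, mul_pos hl hh], hlh⟩)

/-- An estimate of the products at the heights `m ± h` propagates to all heights `m ± β` with
`|β| ≤ h`, the coefficient of the edge loss being divided by a lower bound of `cos (l h)`. -/
lemma norm_crossDiff_le_of_outer {ε l X m h β c τ ρ E : ℝ} (hε : ε ∈ Ioo (0 : ℝ) 1) (hl : 0 < l)
    (hX : 0 < X) (hh : 0 < h) (hm : h < m) (hlh : l * h ≤ Real.pi / 2) (hρ : 0 < ρ)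
    (hρcos : ρ ≤ Real.cos (l * h)) (hτ : 1 ≤ τ) (hc : c ≤ 1)
    (hE : 2 * (lineSup F (m + h) * lineSup F (m - h)) ≤ E)
    (hD : ∀ x : ℝ, |x| ≤ X → ‖crossDiff F (m + h) (m - h) x‖ ≤ E * ε ^ (c - τ * edgeLoss l X x))
    (hβ : |β| ≤ h) {x : ℝ} (hx : |x| ≤ X) :
    ‖crossDiff F (m + β) (m - β) x‖ ≤ E * ε ^ (c - τ / ρ * edgeLoss l X x) := by
  obtain ⟨hε0, hε1⟩ := hε
  have hE0 : 0 ≤ E := by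
    have h1 := mul_nonneg (lineSup_nonneg F (m + h)) (lineSup_nonneg F (m - h))
    linarith
  have hτρ : 0 < τ / ρ := by positivity
  set g : ℂ → ℂ := fun z => Real.log ε *
    (c - (τ / ρ : ℝ) * (Complex.cosh (l * z) / (Real.cosh (l * X) : ℝ))) with hg
  have hre : ∀ x y : ℝ, Real.exp (g (x + y * Complex.I)).re =
      ε ^ (c - τ / ρ * (edgeLoss l X x * Real.cos (l * y))) := fun x y => by
    rw [Real.rpow_def_of_pos hε0]
    congr 1
    simp only [hg]
    rw [Complex.re_ofReal_mul, Complex.sub_re, Complex.re_ofReal_mul, re_cosh_div,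
      Complex.ofReal_re]
  have hcos : ∀ y : ℝ, |y| ≤ h → ρ ≤ Real.cos (l * y) := fun y hy => by
    rw [← Real.cos_abs (l * y), abs_mul, abs_of_pos hl]
    refine hρcos.trans (Real.cos_le_cos_of_nonneg_of_le_pi (by positivity) ?_ (by gcongr))
    linarith [Real.pi_pos]
  have hends : ∀ x y : ℝ, |x| ≤ X → |y| = h → ‖crossDiff F (m + h) (m - h) x‖ ≤
      E * ε ^ (c - τ / ρ * (edgeLoss l X x * Real.cos (l * y))) := fun x y hx hy => by
    refine (hD x hx).trans (mul_le_mul_of_nonneg_left ?_ hE0)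
    refine Real.rpow_le_rpow_of_exponent_ge hε0 hε1.le ?_
    have h1 : τ ≤ τ / ρ * Real.cos (l * y) := by
      rw [div_mul_eq_mul_div, le_div_iff₀ hρ]
      exact mul_le_mul_of_nonneg_left (hcos y hy.le) (by linarith)
    nlinarith [edgeLoss_pos l X x]
  have key := norm_le_mul_exp_of_rectangle (H := crossHol F m) (g := g) (X := X) (y₀ := -h)
    (y₁ := h) (B := E) hX (by linarith)
    (fun z hz0 hz1 => hF.differentiableAt_crossHol (by linarith) (by linarith))
    (by rw [hg]; fun_prop) ?_ ?_ ?_ hx (abs_le.1 hβ).1 (abs_le.1 hβ).2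
  · rw [hre, crossHol_apply] at key
    refine key.trans (mul_le_mul_of_nonneg_left ?_ hE0)
    refine Real.rpow_le_rpow_of_exponent_ge hε0 hε1.le ?_
    have := mul_le_mul_of_nonneg_left (Real.cos_le_one (l * β)) (edgeLoss_pos l X x).le
    have := mul_le_mul_of_nonneg_left this hτρ.le
    linarith
  · intro x y hx hy0 hyh
    rw [hre, crossHol_apply, edgeLoss_of_abs_eq l hX hx, one_mul]
    have h1 := hF.norm_crossDiff_le (v := m + y) (w := m - y) (by linarith) (by linarith) x
    have h2 := hF.lineSup_mul_le (v := m + y) (w := m - y) (v' := m + h) (w' := m - h)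
      (by ring) (by linarith) (by linarith) (by linarith)
    refine (h1.trans (by linarith : _ ≤ E)).trans (le_mul_of_one_le_right hE0 ?_)
    refine Real.one_le_rpow_of_pos_of_le_one_of_nonpos hε0 hε1.le ?_
    have h3 : 1 ≤ τ / ρ * Real.cos (l * y) := by
      rw [div_mul_eq_mul_div, one_le_div hρ]
      nlinarith [hcos y (abs_le.2 ⟨hy0, hyh⟩)]
    linarith
  · intro x hx
    rw [hre, crossHol_apply, sub_neg_eq_add, ← sub_eq_add_neg, norm_crossDiff_swap]
    exact hends x _ hx (by rw [abs_neg, abs_of_pos hh])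
  · intro x hx
    rw [hre, crossHol_apply]
    exact hends x _ hx (abs_of_pos hh)

end IsHalfPlanePair
end CauchyWavelet

/-! ### Induction over pairs of heights -/

namespace CauchyWavelet

/-- The height `T / a ^ (2 s + 2)`, the lower height of the pair reached after `s` steps. -/
noncomputable def lowHeight (a T : ℝ) (s : ℕ) : ℝ := T / a ^ (2 * s + 2)

/-- The height paired with `lowHeight a T s`. The sequence is determined by
`highHeight 0 + lowHeight 0 = 2 a * lowHeight 0` and by the requirement that the pair of index
`s + 1` has the same midpoint as `highHeight s` and the reflection of `lowHeight s` through
`a * lowHeight (s + 1)`. -/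
noncomputable def highHeight (a T : ℝ) (s : ℕ) : ℝ :=
  2 * T / (a + 1) + (a - 1) / (a + 1) * lowHeight a T s

/-- The ratio of the suprema at the heights `D * a * lowHeight s` and `lowHeight s`. -/
noncomputable def supRatio (F : Fin 2 → ℂ → ℂ) (a T D : ℝ) (s : ℕ) : ℝ :=
  lineSup F (D * (a * lowHeight a T s)) / lineSup F (lowHeight a T s)

lemma lowHeight_pos {a T : ℝ} (ha : 1 < a) (hT : 0 < T) (s : ℕ) : 0 < lowHeight a T s := by
  unfold lowHeight; positivity

lemma lowHeight_succ {a : ℝ} (ha : 1 < a) (T : ℝ) (s : ℕ) :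
    lowHeight a T s = a ^ 2 * lowHeight a T (s + 1) := by
  have : a ≠ 0 := by positivity
  unfold lowHeight; field_simp; ring

lemma sq_mul_lowHeight_le {a T : ℝ} (ha : 1 < a) (hT : 0 < T) (s : ℕ) :
    a ^ 2 * lowHeight a T s ≤ T := by
  rw [lowHeight, mul_div_assoc', div_le_iff₀ (by positivity), mul_comm]
  exact mul_le_mul_of_nonneg_left (pow_le_pow_right₀ ha.le (by omega)) hT.le

lemma highHeight_add_lowHeight_zero {a : ℝ} (ha : 1 < a) (T : ℝ) :
    highHeight a T 0 + lowHeight a T 0 = 2 * (a * lowHeight a T 0) := by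
  have : a ≠ 0 := by positivity
  unfold highHeight lowHeight; field_simp; ring

lemma highHeight_add_reflection {a : ℝ} (ha : 1 < a) (T : ℝ) (s : ℕ) :
    highHeight a T s + (2 - a) * (a * lowHeight a T (s + 1)) =
      highHeight a T (s + 1) + lowHeight a T (s + 1) := by
  rw [highHeight, highHeight, lowHeight_succ ha T s]
  field_simp; ring

lemma highHeight_le {a T : ℝ} (ha : 1 < a) (hT : 0 < T) (s : ℕ) : highHeight a T s ≤ T := by
  have h := sq_mul_lowHeight_le ha hT s
  have h0 := lowHeight_pos ha hT s
  have h1 : lowHeight a T s ≤ T :=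
    (le_mul_of_one_le_left h0.le (one_le_pow₀ ha.le)).trans h
  rw [highHeight, div_mul_eq_mul_div, ← add_div, div_le_iff₀ (by linarith)]
  nlinarith

lemma mul_lowHeight_lt_highHeight {a T : ℝ} (ha : 1 < a) (hT : 0 < T) (s t : ℕ) :
    a * lowHeight a T s < highHeight a T t := by
  have h := sq_mul_lowHeight_le ha hT s
  have h0 := lowHeight_pos ha hT s
  have h1 := lowHeight_pos ha hT t
  have h2 : a * lowHeight a T s < 2 * T / (a + 1) := by
    rw [lt_div_iff₀ (by linarith)]
    nlinarith [mul_pos h0 (show 0 < a * (a - 1) by nlinarith)]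
  have h3 : 0 < (a - 1) / (a + 1) * lowHeight a T t :=
    mul_pos (div_pos (by linarith) (by linarith)) h1
  rw [highHeight]; linarith

lemma highHeight_succ_le {a T : ℝ} (ha : 1 < a) (hT : 0 < T) (s : ℕ) :
    highHeight a T (s + 1) ≤ highHeight a T s := by
  rw [highHeight, highHeight, lowHeight_succ ha T s]
  have h0 := lowHeight_pos ha hT (s + 1)
  have h1 : 0 < (a - 1) / (a + 1) := div_pos (by linarith) (by linarith)
  have h2 : lowHeight a T (s + 1) ≤ a ^ 2 * lowHeight a T (s + 1) :=
    le_mul_of_one_le_left h0.le (one_le_pow₀ ha.le)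
  nlinarith

/-- A cosine estimate which keeps the accumulated edge loss below `4`. -/
lemma one_div_cos_pow_le (n : ℕ) :
    (1 / Real.cos (Real.pi / (2 * ((n : ℝ) + 2)))) ^ n ≤ 4 := by
  set θ := Real.pi / (2 * ((n : ℝ) + 2)) with hθ
  have hn : (0 : ℝ) ≤ n := n.cast_nonneg
  have hθ2 : θ ^ 2 * (4 * ((n : ℝ) + 2) ^ 2) ≤ 10 := by
    have : θ ^ 2 * (4 * ((n : ℝ) + 2) ^ 2) = Real.pi ^ 2 := by rw [hθ]; field_simp; ring
    rw [this]; nlinarith [Real.pi_lt_d2, Real.pi_pos]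
  have hθ1 : θ ^ 2 ≤ 10 / 16 := by
    have := mul_nonneg (sq_nonneg θ) (show 0 ≤ 4 * ((n : ℝ) + 2) ^ 2 - 16 by nlinarith)
    linarith
  have hcos := Real.one_sub_sq_div_two_le_cos (x := θ)
  have hbern := one_add_mul_le_pow (a := -(θ ^ 2 / 2)) (by linarith) n
  have hpow : (1 + -(θ ^ 2 / 2)) ^ n ≤ Real.cos θ ^ n :=
    pow_le_pow_left₀ (by linarith) (by linarith) n
  have hnθ : (n : ℝ) * θ ^ 2 ≤ 1 := by nlinarith [sq_nonneg θ, sq_nonneg ((n : ℝ) - 2)]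
  have h4 : 1 / 4 ≤ Real.cos θ ^ n := by linarith
  rw [one_div_pow, div_le_iff₀ (by linarith)]
  linarith

namespace IsHalfPlanePair

variable {F : Fin 2 → ℂ → ℂ} (hF : IsHalfPlanePair F)
include hF

lemma one_le_supRatio {a T D : ℝ} (ha1 : 1 < a) (hT : 0 < T) (hD0 : 0 < D) (hD : D < 2 - a)
    {s : ℕ} (hpos : 0 < lineSup F (lowHeight a T s)) : 1 ≤ supRatio F a T D s := by
  rw [supRatio, one_le_div hpos]
  have h0 := lowHeight_pos ha1 hT s
  have hDa : D * a ≤ 1 := by nlinarith [sq_nonneg (a - 1)]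
  exact hF.lineSup_antitone (by positivity) (by nlinarith)

/-- The estimate at the pair `v, u` and the one of the moduli at `α = u / a` and at `u` give the
estimate at `v` and the reflection `(2 - a) α` of `u` through `α`. -/
lemma norm_crossDiff_reflect_le {a D ε r l X α v A c τ : ℝ} (ha1 : 1 < a) (hD0 : 0 < D)
    (hD : D < 2 - a) (hε : ε ∈ Ioo (0 : ℝ) 1) (hr : 0 < r) (hα : 0 < α) (hv : 0 < v) (hA : 0 ≤ A)
    (hc : c = 1 - (a - 1) / (1 - D)) (hεr : ε ^ (1 - c) ≤ r) (hl : 0 < l) (hX : 0 < X)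
    (hlα : l * α ≤ Real.pi / 2) (hτ : 1 ≤ τ)
    (hmodα : ∀ x : ℝ, |x| ≤ X →
      |‖F 0 (x + α * Complex.I)‖ ^ 2 - ‖F 1 (x + α * Complex.I)‖ ^ 2| ≤ ε * lineSup F α ^ 2)
    (hmod : ∀ x : ℝ, |x| ≤ X →
      |‖F 0 (x + (a * α : ℝ) * Complex.I)‖ ^ 2 - ‖F 1 (x + (a * α : ℝ) * Complex.I)‖ ^ 2|
        ≤ ε * lineSup F (a * α) ^ 2)
    (hlow : ∀ x : ℝ, |x| ≤ X → ∀ i,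
      r * lineSup F (a * α) ≤ ‖F i (x + (a * α : ℝ) * Complex.I)‖)
    (hpos : 0 < lineSup F (a * α))
    (hprev : ∀ x : ℝ, |x| ≤ X → ‖crossDiff F v (a * α) x‖ ≤
      A * (lineSup F v * lineSup F (a * α)) * ε ^ (c - τ * edgeLoss l X x))
    {x : ℝ} (hx : |x| ≤ X) :
    ‖crossDiff F v ((2 - a) * α) x‖ ≤
      lineSup F v * lineSup F (D * α) * ((A + 3) / r) * ε ^ (c - τ * edgeLoss l X x) := by
  obtain ⟨hε0, hε1⟩ := id hε
  have hD1 : 0 < 1 - D := by linarith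
  have hw : 0 < (2 - a) * α := mul_pos (by linarith) hα
  have hfirst := hF.norm_crossDiff_le_of_modulus (α := α) (h := α * (1 - D)) (β := (a - 1) * α)
    hε hl hX (mul_pos hα hD1) (by nlinarith) (le_trans (by nlinarith [mul_pos hl hα]) hlα) hmodα
    (mul_nonneg (by linarith) hα.le) (by nlinarith) hx
  rw [show α + (a - 1) * α = a * α by ring, show α - (a - 1) * α = (2 - a) * α by ring,
    show α - α * (1 - D) = D * α by ring,
    show 1 - (a - 1) * α / (α * (1 - D)) - edgeLoss l X x = c - edgeLoss l X x by
      rw [hc]; field_simp] at hfirst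
  have hq : lineSup F ((2 - a) * α) ≤ lineSup F (D * α) :=
    hF.lineSup_antitone (by positivity) (by nlinarith)
  have hφ := edgeLoss_pos l X x
  set e := ε ^ (c - τ * edgeLoss l X x) with he
  have he0 : 0 < e := Real.rpow_pos_of_pos hε0 _
  have he1 : ε ^ (c - edgeLoss l X x) ≤ e :=
    Real.rpow_le_rpow_of_exponent_ge hε0 hε1.le (by nlinarith)
  have he2 : ε ≤ r * e := by
    have h1 : ε ^ c ≤ e := Real.rpow_le_rpow_of_exponent_ge hε0 hε1.le (by nlinarith)
    calc ε = ε ^ (1 - c) * ε ^ c := by rw [← Real.rpow_add hε0]; simp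
      _ ≤ r * e := by gcongr
  have hμv := lineSup_nonneg F v
  have hμw := lineSup_nonneg F ((2 - a) * α)
  have key := norm_sub_le_of_common_factor (r := r) hpos hr hμw hμv
    (hF.norm_le_lineSup hv 1 x) (hF.norm_le_lineSup hw 0 x) (hlow x hx 0) (hlow x hx 1)
    (hprev x hx) hfirst (hmod x hx)
  refine key.trans ?_
  set V := lineSup F v
  set U := lineSup F (a * α)
  set W := lineSup F ((2 - a) * α)
  set q := lineSup F (D * α)
  calc A * (V * U) * e * (W / (r * U)) + V / (r * U) * (2 * (U * q) * ε ^ (c - edgeLoss l X x))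
        + ε * (V * W) / r ^ 2
      ≤ A * (V * U) * e * (q / (r * U)) + V / (r * U) * (2 * (U * q) * e)
        + r * e * (V * q) / r ^ 2 := by
        have hq0 : 0 ≤ q := hμw.trans hq
        gcongr
    _ = V * q * ((A + 3) / r) * e := by field_simp; ring

/-- The induction over pairs of heights: starting from `highHeight 0, lowHeight 0`, symmetric about
a line of known modulus, each step reflects the lower height through the next such line and then
moves both heights towards each other. -/
lemma norm_crossDiff_high_low_le {a T D ε r l X ρ c : ℝ} (ha1 : 1 < a) (hT : 0 < T)
    (hD0 : 0 < D) (hD : D < 2 - a) (hε : ε ∈ Ioo (0 : ℝ) 1) (hr : 0 < r) (hr1 : r ≤ 1)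
    (hc : c = 1 - (a - 1) / (1 - D)) (hεr : ε ^ (1 - c) ≤ r) (hl : 0 < l) (hX : 0 < X)
    (hlT : l * T ≤ Real.pi / 2) (hρ : 0 < ρ) (hρcos : ρ ≤ Real.cos (l * T / 2)) {S : ℕ}
    (hmodα : ∀ s < S, ∀ x : ℝ, |x| ≤ X →
      |‖F 0 (x + (a * lowHeight a T s : ℝ) * Complex.I)‖ ^ 2
          - ‖F 1 (x + (a * lowHeight a T s : ℝ) * Complex.I)‖ ^ 2|
        ≤ ε * lineSup F (a * lowHeight a T s) ^ 2)
    (hmod : ∀ s, s + 1 < S → ∀ x : ℝ, |x| ≤ X →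
      |‖F 0 (x + lowHeight a T s * Complex.I)‖ ^ 2 - ‖F 1 (x + lowHeight a T s * Complex.I)‖ ^ 2|
        ≤ ε * lineSup F (lowHeight a T s) ^ 2)
    (hlow : ∀ s, s + 1 < S → ∀ x : ℝ, |x| ≤ X → ∀ i,
      r * lineSup F (lowHeight a T s) ≤ ‖F i (x + lowHeight a T s * Complex.I)‖)
    (hpos : ∀ s, 0 < lineSup F (lowHeight a T s)) :
    ∀ s < S, ∀ x : ℝ, |x| ≤ X →
      ‖crossDiff F (highHeight a T s) (lowHeight a T s) x‖ ≤
        (∏ i ∈ Finset.range (s + 1), supRatio F a T D i) *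
          ((2 + 3 * ∑ i ∈ Finset.range s, r ^ i) / r ^ s) *
          (lineSup F (highHeight a T s) * lineSup F (lowHeight a T s)) *
          ε ^ (c - (1 / ρ) ^ s * edgeLoss l X x) := by
  obtain ⟨hε0, hε1⟩ := id hε
  have hD1 : 0 < 1 - D := by linarith
  have hρ1 : ρ ≤ 1 := hρcos.trans (Real.cos_le_one _)
  have hR : ∀ s, 1 ≤ supRatio F a T D s := fun s => hF.one_le_supRatio ha1 hT hD0 hD (hpos s)
  have hRmul : ∀ s, lineSup F (D * (a * lowHeight a T s)) =
      supRatio F a T D s * lineSup F (lowHeight a T s) := fun s => by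
    rw [supRatio, div_mul_cancel₀ _ (hpos s).ne']
  have haT : ∀ s, a * lowHeight a T s ≤ T := fun s => by
    have := sq_mul_lowHeight_le ha1 hT s
    nlinarith [lowHeight_pos ha1 hT s, mul_pos (show 0 < a by linarith) (lowHeight_pos ha1 hT s)]
  intro s
  induction s with
  | zero =>
    intro hs x hx
    have hU := lowHeight_pos ha1 hT 0
    have hsum := highHeight_add_lowHeight_zero ha1 T
    have hα : 0 < a * lowHeight a T 0 := by positivity
    have h := hF.norm_crossDiff_le_of_modulus (α := a * lowHeight a T 0)
      (h := a * lowHeight a T 0 * (1 - D)) (β := (a - 1) * lowHeight a T 0)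
      hε hl hX (mul_pos hα hD1) (by nlinarith)
      (le_trans (mul_le_mul_of_nonneg_left ((by nlinarith : _ ≤ a * lowHeight a T 0).trans (haT 0))
        hl.le) hlT) (hmodα 0 hs)
      (mul_nonneg (by linarith) hU.le) (by nlinarith [mul_pos hU hD1]) hx
    rw [show a * lowHeight a T 0 + (a - 1) * lowHeight a T 0 = highHeight a T 0 by linarith,
      show a * lowHeight a T 0 - (a - 1) * lowHeight a T 0 = lowHeight a T 0 by ring,
      show a * lowHeight a T 0 - a * lowHeight a T 0 * (1 - D) = D * (a * lowHeight a T 0) by ring,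
      hRmul] at h
    refine h.trans ?_
    have hexp : c - (1 / ρ) ^ 0 * edgeLoss l X x ≤
        1 - (a - 1) * lowHeight a T 0 / (a * lowHeight a T 0 * (1 - D)) - edgeLoss l X x := by
      have h1 : (a - 1) * lowHeight a T 0 / (a * lowHeight a T 0 * (1 - D)) ≤
          (a - 1) / (1 - D) := by
        rw [div_le_div_iff₀ (by positivity) hD1]
        have : 0 ≤ (a - 1) * (a - 1) * (lowHeight a T 0 * (1 - D)) := by
          have := mul_pos hU hD1
          nlinarith [mul_self_nonneg (a - 1)]
        nlinarith
      rw [hc, pow_zero, one_mul]; linarith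
    calc 2 * (lineSup F (highHeight a T 0) * (supRatio F a T D 0 * lineSup F (lowHeight a T 0))) *
          ε ^ (1 - (a - 1) * lowHeight a T 0 / (a * lowHeight a T 0 * (1 - D)) - edgeLoss l X x)
        ≤ 2 * (lineSup F (highHeight a T 0) * (supRatio F a T D 0 * lineSup F (lowHeight a T 0))) *
          ε ^ (c - (1 / ρ) ^ 0 * edgeLoss l X x) := by
          refine mul_le_mul_of_nonneg_left
            (Real.rpow_le_rpow_of_exponent_ge hε0 hε1.le hexp) ?_
          have := lineSup_nonneg F (highHeight a T 0)
          have := hpos 0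
          have := hR 0
          positivity
      _ = _ := by simp; left; ring
  | succ s ih =>
    intro hs x hx
    have hU' := lowHeight_pos ha1 hT (s + 1)
    have hα : 0 < a * lowHeight a T (s + 1) := by positivity
    have hau : a * (a * lowHeight a T (s + 1)) = lowHeight a T s := by
      rw [lowHeight_succ ha1 T s]; ring
    have hv : 0 < highHeight a T s := hα.trans (mul_lowHeight_lt_highHeight ha1 hT _ _)
    set P := ∏ i ∈ Finset.range (s + 1), supRatio F a T D i with hP
    set G := 2 + 3 * ∑ i ∈ Finset.range s, r ^ i with hG
    have hP1 : 1 ≤ P := Finset.one_le_prod fun i _ => hR i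
    have hG0 : 0 ≤ G := by positivity
    have hτ : 1 ≤ (1 / ρ) ^ s := one_le_pow₀ (by rw [le_div_iff₀ hρ]; linarith)
    have hrs : 0 < r ^ s := pow_pos hr s
    have hA : 0 ≤ P * (G / r ^ s) := by positivity
    have hrefl := fun x hx => hF.norm_crossDiff_reflect_le (x := x) ha1 hD0 hD hε hr hα hv hA hc
      hεr hl hX (le_trans (mul_le_mul_of_nonneg_left (haT (s + 1)) hl.le) hlT) hτ
      (hmodα (s + 1) hs) (hau.symm ▸ hmod s hs) (hau.symm ▸ hlow s hs) (hau.symm ▸ hpos s)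
      (hau.symm ▸ ih (by omega)) hx
    set w := (2 - a) * (a * lowHeight a T (s + 1)) with hw
    have hw0 : 0 < w := mul_pos (by linarith) hα
    have hsum : highHeight a T s + w = highHeight a T (s + 1) + lowHeight a T (s + 1) :=
      highHeight_add_reflection ha1 T s
    have hvle : highHeight a T (s + 1) ≤ highHeight a T s := highHeight_succ_le ha1 hT s
    have hltv : lowHeight a T (s + 1) < highHeight a T (s + 1) :=
      lt_trans (by nlinarith) (mul_lowHeight_lt_highHeight ha1 hT (s + 1) (s + 1))
    have hvT := highHeight_le ha1 hT s
    have hlh : l * ((highHeight a T s - w) / 2) ≤ l * T / 2 := by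
      rw [mul_div_assoc]; exact mul_le_mul_of_nonneg_left (by linarith) hl.le
    have hlh0 : 0 ≤ l * ((highHeight a T s - w) / 2) := mul_nonneg hl.le (by linarith)
    have hlT0 : 0 < l * T := mul_pos hl hT
    have hqle : lineSup F w ≤ lineSup F (D * (a * lowHeight a T (s + 1))) :=
      hF.lineSup_antitone (by positivity) (mul_le_mul_of_nonneg_right hD.le hα.le)
    have hA3 : 2 ≤ (P * (G / r ^ s) + 3) / r := by
      rw [le_div_iff₀ hr]; linarith
    -- The pair `v, w` with `w` the reflection of `lowHeight s` has the same midpoint as the next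
    -- pair and encloses it.
    have hout := hF.norm_crossDiff_le_of_outer
      (m := (highHeight a T s + w) / 2) (h := (highHeight a T s - w) / 2)
      (β := (highHeight a T (s + 1) - lowHeight a T (s + 1)) / 2) (c := c) (τ := (1 / ρ) ^ s)
      (ρ := ρ) (E := lineSup F (highHeight a T s) *
        lineSup F (D * (a * lowHeight a T (s + 1))) * ((P * (G / r ^ s) + 3) / r))
      hε hl hX (by linarith) (by linarith) (by linarith) hρ
      (hρcos.trans (Real.cos_le_cos_of_nonneg_of_le_pi hlh0 (by linarith [Real.pi_pos]) hlh))
      hτ (by rw [hc]; have := div_nonneg (show 0 ≤ a - 1 by linarith) hD1.le; linarith)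
    rw [show (highHeight a T s + w) / 2 + (highHeight a T s - w) / 2 = highHeight a T s by ring,
      show (highHeight a T s + w) / 2 - (highHeight a T s - w) / 2 = w by ring,
      show (highHeight a T s + w) / 2 + (highHeight a T (s + 1) - lowHeight a T (s + 1)) / 2
        = highHeight a T (s + 1) by rw [hsum]; ring,
      show (highHeight a T s + w) / 2 - (highHeight a T (s + 1) - lowHeight a T (s + 1)) / 2
        = lowHeight a T (s + 1) by rw [hsum]; ring] at hout
    have hμv := lineSup_nonneg F (highHeight a T s)
    have hμw := lineSup_nonneg F w
    refine (hout ?_ hrefl ?_ hx).trans ?_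
    · calc 2 * (lineSup F (highHeight a T s) * lineSup F w)
          ≤ 2 * (lineSup F (highHeight a T s) * lineSup F (D * (a * lowHeight a T (s + 1)))) := by
            gcongr
        _ = lineSup F (highHeight a T s) * lineSup F (D * (a * lowHeight a T (s + 1))) * 2 := by
            ring
        _ ≤ _ := mul_le_mul_of_nonneg_left hA3 (mul_nonneg hμv (hμw.trans hqle))
    · rw [abs_of_nonneg (by linarith)]; linarith
    · have hmono : lineSup F (highHeight a T s) ≤ lineSup F (highHeight a T (s + 1)) :=
        hF.lineSup_antitone (by linarith) hvle
      have hexp : (1 / ρ) ^ s / ρ = (1 / ρ) ^ (s + 1) := by rw [pow_succ]; ring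
      rw [hexp, hRmul, Finset.prod_range_succ _ (s + 1), Finset.sum_range_succ, ← hP]
      refine mul_le_mul_of_nonneg_right ?_ (by positivity)
      have hconst : P * (G / r ^ s) + 3 ≤ P * ((G + 3 * r ^ s) / r ^ s) := by
        rw [add_div G, mul_div_assoc 3, div_self hrs.ne']; linarith
      have hμ' := lineSup_nonneg F (highHeight a T (s + 1))
      have hR0 : 0 ≤ supRatio F a T D (s + 1) * lineSup F (lowHeight a T (s + 1)) :=
        mul_nonneg (zero_le_one.trans (hR _)) (hpos _).le
      have hring : ∀ V R u t : ℝ, V * (R * u) * (P * (t / r ^ s) / r) =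
          P * R * (t / (r ^ s * r)) * (V * u) := fun V R u t => by field_simp
      rw [show 2 + 3 * (∑ i ∈ Finset.range s, r ^ i + r ^ s) = G + 3 * r ^ s by rw [hG]; ring,
        pow_succ, ← hring]
      exact mul_le_mul (mul_le_mul_of_nonneg_right hmono hR0)
        (div_le_div_of_nonneg_right hconst hr.le) (by linarith) (mul_nonneg hμ' hR0)

/-- The stability estimate in terms of holomorphic functions on the half plane. -/
lemma norm_crossDiff_le_of_moduli {a T D ε r M c : ℝ} (ha1 : 1 < a) (hT : 0 < T)
    (hD0 : 0 < D) (hD : D < 2 - a) (hε : ε ∈ Ioo (0 : ℝ) 1) (hr : r ∈ Ioo (0 : ℝ) 1)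
    (hc : c = 1 - (a - 1) / (1 - D)) (hεr : ε ^ (1 - c) ≤ r) (hM : 0 < M) (n : ℕ)
    (hmodα : ∀ s < n + 1, ∀ x : ℝ, |x| ≤ M * T →
      |‖F 0 (x + (a * lowHeight a T s : ℝ) * Complex.I)‖ ^ 2
          - ‖F 1 (x + (a * lowHeight a T s : ℝ) * Complex.I)‖ ^ 2|
        ≤ ε * lineSup F (a * lowHeight a T s) ^ 2)
    (hmod : ∀ s, s + 1 < n + 1 → ∀ x : ℝ, |x| ≤ M * T →
      |‖F 0 (x + lowHeight a T s * Complex.I)‖ ^ 2 - ‖F 1 (x + lowHeight a T s * Complex.I)‖ ^ 2|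
        ≤ ε * lineSup F (lowHeight a T s) ^ 2)
    (hlow : ∀ s, s + 1 < n + 1 → ∀ x : ℝ, |x| ≤ M * T → ∀ i,
      r * lineSup F (lowHeight a T s) ≤ ‖F i (x + lowHeight a T s * Complex.I)‖)
    (hpos : 0 < lineSup F (highHeight a T n)) {x : ℝ} (hx : |x| ≤ M * T / 2) :
    ‖crossDiff F (highHeight a T n) (lowHeight a T n) x‖ ≤
      6 / (1 - r) * (∏ i ∈ Finset.range (n + 1), supRatio F a T D i) / r ^ (n + 1) *
        ε ^ (c - 4 * (Real.exp (-Real.pi * M / (2 * (n + 2))) /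
          (1 - Real.exp (-Real.pi * M / (2 * (n + 2)))))) *
        (lineSup F (highHeight a T n) * lineSup F (lowHeight a T n)) := by
  obtain ⟨hε0, hε1⟩ := id hε
  obtain ⟨hr0, hr1⟩ := hr
  -- With this `l`, `exp (-(l X / 2))` is the exponential of the claim for `X = M T`, and the
  -- strips `|β| ≤ h` of the induction have `h ≤ T / 2`, hence `cos (l h) ≥ cos (π / (2 (n + 2)))`.
  set l := Real.pi / ((n + 2) * T) with hl_def
  have hn : (0 : ℝ) ≤ n := n.cast_nonneg
  have hl : 0 < l := by positivity
  have hlT : l * T = Real.pi / (n + 2) := by rw [hl_def]; field_simp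
  have hlT2 : l * T ≤ Real.pi / 2 := by
    rw [hlT]; exact div_le_div_of_nonneg_left Real.pi_pos.le (by norm_num) (by linarith)
  have hX : 0 < M * T := mul_pos hM hT
  have hθ : l * T / 2 = Real.pi / (2 * ((n : ℝ) + 2)) := by rw [hlT]; field_simp
  have hρ : 0 < Real.cos (l * T / 2) := Real.cos_pos_of_mem_Ioo
    ⟨by have := mul_pos hl hT; linarith [Real.pi_pos], by linarith [Real.pi_pos]⟩
  have hμ : ∀ s, 0 < lineSup F (lowHeight a T s) := fun s => by
    have h0 := lowHeight_pos ha1 hT s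
    refine hpos.trans_le (hF.lineSup_antitone h0 ?_)
    exact le_trans (by nlinarith) (mul_lowHeight_lt_highHeight ha1 hT s n).le
  have key := hF.norm_crossDiff_high_low_le ha1 hT hD0 hD hε hr0 hr1.le hc hεr hl hX hlT2 hρ le_rfl
    hmodα hmod hlow hμ n (by omega) x (by linarith)
  have hτ : (1 / Real.cos (l * T / 2)) ^ n ≤ 4 := by rw [hθ]; exact one_div_cos_pow_le n
  have hloss := edgeLoss_le_of_abs_le_half hl hX hx
  have hq : -(l * (M * T) / 2) = -Real.pi * M / (2 * (n + 2)) := by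
    rw [hl_def]; field_simp
  rw [hq] at hloss
  have hP1 : 1 ≤ ∏ i ∈ Finset.range (n + 1), supRatio F a T D i :=
    Finset.one_le_prod fun i _ => hF.one_le_supRatio ha1 hT hD0 hD (hμ i)
  have hgeom : 2 + 3 * ∑ i ∈ Finset.range n, r ^ i ≤ 6 / (1 - r) := by
    have h1 : (∑ i ∈ Finset.range n, r ^ i) * (1 - r) = 1 - r ^ n := by
      have := geom_sum_mul r n
      linarith
    rw [le_div_iff₀ (by linarith), add_mul, mul_assoc, h1]
    have := pow_pos hr0 n
    linarith
  have hrn : r ^ (n + 1) ≤ r ^ n := pow_le_pow_of_le_one hr0.le hr1.le (Nat.le_succ n)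
  refine key.trans ?_
  rw [mul_right_comm]
  refine mul_le_mul_of_nonneg_right ?_ (mul_nonneg hpos.le (hμ n).le)
  refine mul_le_mul ?_ ?_ (by positivity) ?_
  · rw [← mul_div_assoc, mul_comm (6 / (1 - r))]
    gcongr
  · refine Real.rpow_le_rpow_of_exponent_ge hε0 hε1.le ?_
    have := mul_le_mul hτ hloss (edgeLoss_pos l (M * T) x).le (by norm_num)
    linarith
  · have : 0 < 1 - r := by linarith
    positivity

end IsHalfPlanePair
end CauchyWavelet

/-! ### Return to the wavelet transform -/

namespace CauchyWavelet

lemma isHalfPlanePair_holExt {p : ℝ} (hp : 0 < p) {f : Fin 2 → ℝ → ℂ}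
    (hf : ∀ s, MemLp (f s) 2 volume) : IsHalfPlanePair fun s => holExt p (f s) where
  differentiableAt s _ hz := holExt_differentiableAt hp (hf s) hz
  bounded δ hδ := by
    choose C hC using fun s => holExt_bounded hp (hf s) hδ
    refine ⟨max (C 0) (C 1), fun s z hz => (hC s z hz).trans ?_⟩
    fin_cases s
    · exact le_max_left _ _
    · exact le_max_right _ _

lemma norm_wt_eq {a p : ℝ} (ha : 0 < a) (hp : 0 < p) (f : ℝ → ℂ) (l x : ℝ) :
    ‖wt a p f l x‖ = a ^ (p * l) * ‖holExt p f (x + (a ^ l : ℝ) * Complex.I)‖ := by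
  rw [wt_eq ha hp, norm_mul, Complex.norm_real, Real.norm_of_nonneg (by positivity)]

lemma supN_eq {a p : ℝ} (ha : 0 < a) (hp : 0 < p) (f : Fin 2 → ℝ → ℂ) (l : ℝ) :
    supN a p f l = a ^ (p * l) * lineSup (fun s => holExt p (f s)) (a ^ l) := by
  rw [supN, lineSup, Real.mul_iSup_of_nonneg (by positivity)]
  simp only [norm_wt_eq ha hp]

lemma supN_nonneg (a p : ℝ) (f : Fin 2 → ℝ → ℂ) (l : ℝ) : 0 ≤ supN a p f l :=
  Real.iSup_nonneg fun _ => norm_nonneg _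

lemma constC_nonneg {a : ℝ} (ha : 0 < a) (p : ℝ) (f : Fin 2 → ℝ → ℂ) (j : ℤ) (K k : ℕ) {κ : ℝ}
    (hκ : κ < 1) : 0 ≤ constC a p f j K k κ := by
  have h : Real.sqrt κ < 1 := by
    rw [Real.sqrt_lt' one_pos]; simpa using hκ
  refine mul_nonneg (div_nonneg (by norm_num) (by linarith)) (Finset.prod_nonneg fun s _ => ?_)
  exact mul_nonneg (by positivity) (div_nonneg (supN_nonneg _ _ _ _) (supN_nonneg _ _ _ _))

lemma norm_conj_wt_sub {a p : ℝ} (ha : 0 < a) (hp : 0 < p) (f : Fin 2 → ℝ → ℂ) (l m x : ℝ) :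
    ‖conj (wt a p (f 0) l x) * wt a p (f 0) m x - conj (wt a p (f 1) l x) * wt a p (f 1) m x‖ =
      a ^ (p * l) * a ^ (p * m) * ‖crossDiff (fun s => holExt p (f s)) (a ^ l) (a ^ m) x‖ := by
  rw [norm_crossDiff_swap]
  have h : conj (wt a p (f 0) l x) * wt a p (f 0) m x - conj (wt a p (f 1) l x) * wt a p (f 1) m x =
      ((a ^ (p * l) * a ^ (p * m) : ℝ) : ℂ) *
        crossDiff (fun s => holExt p (f s)) (a ^ m) (a ^ l) x := by
    simp only [wt_eq ha hp, crossDiff, map_mul, Complex.conj_ofReal]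
    push_cast; ring
  rw [h, norm_mul, Complex.norm_real, Real.norm_of_nonneg (by positivity), norm_crossDiff_swap]

lemma lowHeight_rpow {a : ℝ} (ha : 0 < a) (j : ℤ) (K s : ℕ) :
    lowHeight a (a ^ ((j : ℝ) + K)) s = a ^ (idx j K s - 2) := by
  have h : idx j K s - 2 = ((j : ℝ) + K) - ((2 * s + 2 : ℕ) : ℝ) := by
    rw [idx]; push_cast; ring
  rw [lowHeight, h, Real.rpow_sub ha, Real.rpow_natCast]

lemma mul_lowHeight_rpow {a : ℝ} (ha : 0 < a) (j : ℤ) (K s : ℕ) :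
    a * lowHeight a (a ^ ((j : ℝ) + K)) s = a ^ (idx j K s - 1) := by
  rw [lowHeight_rpow ha, show idx j K s - 1 = 1 + (idx j K s - 2) by ring, Real.rpow_add ha,
    Real.rpow_one]

lemma constC_eq {a p : ℝ} (ha : 0 < a) (hp : 0 < p) (f : Fin 2 → ℝ → ℂ) (j : ℤ) (K k : ℕ) (κ : ℝ) :
    constC a p f j K k κ = 6 / (1 - Real.sqrt κ) * ∏ s ∈ Finset.range (K / 2),
      supRatio (fun s => holExt p (f s)) a (a ^ ((j : ℝ) + K)) (a ^ (-(k : ℝ))) s := by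
  rw [constC]
  congr 1
  refine Finset.prod_congr rfl fun s _ => ?_
  have h1 : a ^ (-(k : ℝ)) * (a * lowHeight a (a ^ ((j : ℝ) + K)) s) = a ^ (idx j K s - 1 - k) := by
    rw [mul_lowHeight_rpow ha, ← Real.rpow_add ha]; congr 1; ring
  rw [supRatio, h1, lowHeight_rpow ha, supN_eq ha hp, supN_eq ha hp]
  have h2 : a ^ (p * (idx j K s - 2)) =
      a ^ (p * ((k : ℝ) - 1)) * a ^ (p * (idx j K s - 1 - k)) := by
    rw [← Real.rpow_add ha]; congr 1; ring
  have h3 : a ^ (p * ((k : ℝ) - 1)) ≠ 0 := (Real.rpow_pos_of_pos ha _).ne'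
  have h4 : a ^ (p * (idx j K s - 1 - k)) ≠ 0 := (Real.rpow_pos_of_pos ha _).ne'
  rw [h2, ← mul_div_assoc, ← mul_assoc, mul_div_mul_left _ _ (mul_ne_zero h3 h4)]

lemma indexJ_eq {a : ℝ} (ha : 1 < a) (j : ℤ) (K : ℕ) :
    a ^ indexJ a j K = 2 / (a + 1) * a ^ ((j : ℝ) + K) + (a - 1) / (a + 1) * a ^ (j : ℝ) := by
  have ha0 : 0 < a := by linarith
  have h1 : 0 < (a - 1) / (a + 1) := div_pos (by linarith) (by linarith)
  exact Real.rpow_logb ha0 ha.ne' (by positivity)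

lemma indexJ_mem {a : ℝ} (ha : 1 < a) (j : ℤ) (K : ℕ) :
    indexJ a j K ∈ Icc ((j : ℝ) + K - 1) ((j : ℝ) + K) := by
  have ha0 : 0 < a := by linarith
  have hj : 0 < a ^ (j : ℝ) := Real.rpow_pos_of_pos ha0 _
  have hT : 0 < a ^ ((j : ℝ) + K) := Real.rpow_pos_of_pos ha0 _
  have hjK : a ^ (j : ℝ) ≤ a ^ ((j : ℝ) + K) :=
    Real.rpow_le_rpow_of_exponent_le ha.le (by linarith [K.cast_nonneg (α := ℝ)])
  constructor
  · rw [← Real.rpow_le_rpow_left_iff ha, indexJ_eq ha, Real.rpow_sub_one ha0.ne',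
      div_mul_eq_mul_div, div_mul_eq_mul_div, ← add_div, div_le_div_iff₀ ha0 (by linarith)]
    nlinarith [mul_pos (mul_pos ha0 hj) (sub_pos.2 ha), mul_pos hT (sub_pos.2 ha)]
  · rw [← Real.rpow_le_rpow_left_iff ha, indexJ_eq ha, div_mul_eq_mul_div, div_mul_eq_mul_div,
      ← add_div, div_le_iff₀ (by linarith)]
    nlinarith

end CauchyWavelet

open CauchyWavelet in
theorem mainTheorem8
    (a : ℝ) (ha1 : 1 < a) (ha2 : a < 2)
    (p : ℝ) (hp : 0 < p)
    (f : Fin 2 → ℝ → ℂ)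
    (hf : ∀ s, MemLp (f s) 2 volume)
    (hf0 : ∀ s, ¬ (f s =ᵐ[volume] 0))
    (j : ℤ)
    (K : ℕ) (hK : 0 < K) (hKeven : Even K)
    (ε κ : ℝ) (hε : ε ∈ Ioo (0 : ℝ) 1) (hκ : κ ∈ Ioo (0 : ℝ) 1)
    (M : ℝ) (hM : 0 < M)
    (k : ℕ) (hk : 0 < k) (hka : a ^ (-(k : ℝ)) < 2 - a)
    (hκε : ε ^ (2 * (1 - CauchyWavelet.expC a k)) ≤ κ)
    (h₁ : ∀ l : ℤ, j + 1 ≤ l → l ≤ j + K →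
      ∀ x ∈ Icc (-(M * a ^ ((j : ℝ) + K))) (M * a ^ ((j : ℝ) + K)),
        |‖CauchyWavelet.wt a p (f 0) l x‖ ^ 2 - ‖CauchyWavelet.wt a p (f 1) l x‖ ^ 2|
          ≤ ε * CauchyWavelet.supN a p f l ^ 2)
    (h₂ : ∀ l : ℤ, j + 1 ≤ l → l ≤ j + K →
      ∀ x ∈ Icc (-(M * a ^ ((j : ℝ) + K))) (M * a ^ ((j : ℝ) + K)), ∀ s : Fin 2,
        κ * CauchyWavelet.supN a p f l ^ 2 ≤ ‖CauchyWavelet.wt a p (f s) l x‖ ^ 2) :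
    (CauchyWavelet.indexJ a j K ∈ Icc ((j : ℝ) + K - 1) ((j : ℝ) + K) ∧
      a ^ CauchyWavelet.indexJ a j K
        = 2 / (a + 1) * a ^ ((j : ℝ) + K) + (a - 1) / (a + 1) * a ^ (j : ℝ)) ∧
    ∀ x ∈ Icc (-(M * a ^ ((j : ℝ) + K) / 2)) (M * a ^ ((j : ℝ) + K) / 2),
      1 / (CauchyWavelet.supN a p f (CauchyWavelet.indexJ a j K) *
            CauchyWavelet.supN a p f j) *
        ‖conj (CauchyWavelet.wt a p (f 0) (CauchyWavelet.indexJ a j K) x) *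
              CauchyWavelet.wt a p (f 0) j x
          - conj (CauchyWavelet.wt a p (f 1) (CauchyWavelet.indexJ a j K) x) *
              CauchyWavelet.wt a p (f 1) j x‖
        ≤ CauchyWavelet.constC a p f j K k κ / κ ^ ((K : ℝ) / 4) *
            ε ^ CauchyWavelet.expD a k K M := by
  have ha0 : 0 < a := by linarith
  refine ⟨⟨indexJ_mem ha1 j K, indexJ_eq ha1 j K⟩, fun x hx => ?_⟩
  have hC0 : 0 ≤ constC a p f j K k κ := constC_nonneg ha0 p f j K k hκ.2
  -- If one of the suprema in the denominator vanishes, the left side is `1 / 0 * _ = 0`.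
  rcases (mul_nonneg (supN_nonneg a p f (indexJ a j K)) (supN_nonneg a p f j)).eq_or_lt
    with hN | hN
  · rw [← hN, div_zero, zero_mul]
    exact mul_nonneg (div_nonneg hC0 (Real.rpow_nonneg hκ.1.le _)) (Real.rpow_nonneg hε.1.le _)
  obtain ⟨n, hn⟩ : ∃ n, K = 2 * (n + 1) := by
    obtain ⟨m, hm⟩ := hKeven
    exact ⟨m - 1, by omega⟩
  have hF := isHalfPlanePair_holExt hp hf
  set F : Fin 2 → ℂ → ℂ := fun s => holExt p (f s) with hF_def
  set T := a ^ ((j : ℝ) + K) with hT_def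
  have hT : 0 < T := Real.rpow_pos_of_pos ha0 _
  have hD0 : 0 < a ^ (-(k : ℝ)) := Real.rpow_pos_of_pos ha0 _
  have hr0 : 0 < Real.sqrt κ := Real.sqrt_pos.2 hκ.1
  have hr1 : Real.sqrt κ < 1 := by rw [Real.sqrt_lt' one_pos]; simpa using hκ.2
  have hεr : ε ^ (1 - expC a k) ≤ Real.sqrt κ := by
    refine Real.le_sqrt_of_sq_le ?_
    rw [← Real.rpow_natCast, ← Real.rpow_mul hε.1.le, mul_comm]
    exact_mod_cast hκε
  have hmod : ∀ l : ℤ, j + 1 ≤ l → l ≤ j + K → ∀ x : ℝ, |x| ≤ M * T →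
      |‖F 0 (x + (a ^ (l : ℝ) : ℝ) * Complex.I)‖ ^ 2
        - ‖F 1 (x + (a ^ (l : ℝ) : ℝ) * Complex.I)‖ ^ 2| ≤ ε * lineSup F (a ^ (l : ℝ)) ^ 2 := by
    intro l hl1 hl2 x hx
    have h := h₁ l hl1 hl2 x (abs_le.1 hx)
    have hc : 0 < (a ^ (p * (l : ℝ))) ^ 2 := by positivity
    rw [norm_wt_eq ha0 hp, norm_wt_eq ha0 hp, supN_eq ha0 hp, mul_pow, mul_pow, mul_pow,
      ← mul_sub, abs_mul, abs_of_pos hc, mul_left_comm] at h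
    exact le_of_mul_le_mul_left h hc
  have hlow : ∀ l : ℤ, j + 1 ≤ l → l ≤ j + K → ∀ x : ℝ, |x| ≤ M * T → ∀ i,
      Real.sqrt κ * lineSup F (a ^ (l : ℝ)) ≤ ‖F i (x + (a ^ (l : ℝ) : ℝ) * Complex.I)‖ := by
    intro l hl1 hl2 x hx i
    have h := h₂ l hl1 hl2 x (abs_le.1 hx) i
    have hc : 0 < (a ^ (p * (l : ℝ))) ^ 2 := by positivity
    rw [norm_wt_eq ha0 hp, supN_eq ha0 hp, mul_pow, mul_pow, mul_left_comm] at h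
    refine le_of_sq_le_sq ?_ (norm_nonneg _)
    rw [mul_pow, Real.sq_sqrt hκ.1.le]
    exact le_of_mul_le_mul_left h hc
  have hcast₁ : ∀ s, a * lowHeight a T s = a ^ ((j + K - 2 * s - 1 : ℤ) : ℝ) := fun s => by
    rw [hT_def, mul_lowHeight_rpow ha0, idx]; push_cast; rfl
  have hcast₂ : ∀ s, lowHeight a T s = a ^ ((j + K - 2 * s - 2 : ℤ) : ℝ) := fun s => by
    rw [hT_def, lowHeight_rpow ha0, idx]; push_cast; rfl
  have hlown : lowHeight a T n = a ^ (j : ℝ) := by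
    rw [hcast₂, hn]; congr 1; push_cast; ring
  have hhighn : highHeight a T n = a ^ indexJ a j K := by
    rw [indexJ_eq ha1, highHeight, hlown, mul_div_right_comm]
  have hNJ := supN_eq ha0 hp f (indexJ a j K)
  have hNj := supN_eq ha0 hp f j
  have hpos : 0 < lineSup F (highHeight a T n) := by
    refine (lineSup_nonneg _ _).lt_of_ne' fun h => hN.ne' ?_
    rw [hNJ, ← hhighn, h, mul_zero, zero_mul]
  have hx' : |x| ≤ M * T / 2 := abs_le.2 hx
  have key := hF.norm_crossDiff_le_of_moduli ha1 hT hD0 hka hε ⟨hr0, hr1⟩ (c := expC a k) rfl hεr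
    hM n (fun s hs => by
      rw [hcast₁]; exact hmod _ (by omega) (by omega))
    (fun s hs => by
      rw [hcast₂]; exact hmod _ (by omega) (by omega))
    (fun s hs => by
      rw [hcast₂]; exact hlow _ (by omega) (by omega))
    hpos hx'
  have hpow : Real.sqrt κ ^ (n + 1) = κ ^ ((K : ℝ) / 4) := by
    rw [Real.sqrt_eq_rpow, ← Real.rpow_natCast, ← Real.rpow_mul hκ.1.le, hn]
    congr 1; push_cast; ring
  have hexp : (2 * ((n : ℝ) + 2)) = (K : ℝ) + 2 := by rw [hn]; push_cast; ring
  rw [hpow, hexp, hhighn, hlown] at key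
  rw [one_div_mul_eq_div, div_le_iff₀ hN, norm_conj_wt_sub ha0 hp, constC_eq ha0 hp,
    show K / 2 = n + 1 by omega, expD, hNJ, hNj]
  refine (mul_le_mul_of_nonneg_left key (by positivity)).trans_eq ?_
  ring
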